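/- Conventions. A germ $(X,x)\subset(\mathbb C^n,x)$ of a complex analytic space is given by a proper ideal $\mathcal I_{X,x}$ of the ring $\mathcal O_{\mathbb C^n,x}$ of germs of holomorphic functions; its local ring is $\mathcal O_{X,x}=\mathcal O_{\mathbb C^n,x}/\mathcal I_{X,x}$, with maximal ideal $\mathfrak m_{X,x}$, and $\operatorname{edim}(X)=\dim_{\mathbb C}\mathfrak m_{X,x}/\mathfrak m_{X,x}^2$. A morphism of germs $u:(Y,y)\to(X,x)$ is a homomorphism $u^*:\mathcal O_{X,x}\to\mathcal O_{Y,y}$ induced by a germ of a holomorphic map of the ambient spaces. For a finitely generated $\mathcal O_{X,x}$-module $M$ put $\beta_i^{X}(M)=\dim_{\mathbb C}\operatorname{Tor}_i^{\mathcal O_{X,x}}(M,\mathbb C)$, where $\mathbb C=\mathcal O_{X,x}/\mathfrak m_{X,x}$, and $P^X_M(t)=\sum_{i\ge 0}\beta_i^X(M)t^i$. If $u:(Y,y)\to(X,x)$ has surjective $u^*$, every $\mathcal O_{Y,y}$-module is an $\mathcal O_{X,x}$-module via $u^*$, and we write $\beta_i^X(Y)=\beta_i^X(\mathcal O_{Y,y})$,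 $P^X_Y=P^X_{\mathcal O_{Y,y}}$. Such a $u$ is called large if $P^X_{\mathcal O_{Y,y}/I}=P^Y_{\mathcal O_{Y,y}/I}\,P^X_Y$ for every proper radical ideal $I$ of $\mathcal O_{Y,y}$ (i.e. for every reduced subspace of $(Y,y)$). Setting. Let $(X,x)$, $(Y,y)$, $(Z,z)$ be germs of complex analytic spaces, and let $\alpha:(Z,z)\to(X,x)$ and $\beta:(Z,z)\to(Y,y)$ be morphisms such that $\alpha^*:\mathcal O_{X,x}\to\mathcal O_{Z,z}$ and $\beta^*:\mathcal O_{Y,y}\to\mathcal O_{Z,z}$ are surjective but not isomorphisms. Let $(\mathcal V,v)=(X,x)\sqcup_{(Z,z)}(Y,y)$ be their gluing, i.e. the pushout of $\alpha$ and $\beta$ in the category of germs of complex analytic spaces, with canonical morphisms $f:(X,x)\to(\mathcal V,v)$ and $g:(Y,y)\to(\mathcal V,v)$. The gluing is called weakly large if $P^{\mathcal V}_{\ker\alpha^*}=P^{X}_{\ker\alpha^*}\,P^{\mathcal V}_{X}$, where $\ker\alpha^*$ is regarded as an $\mathcal O_{X,x}$-module; it is called large if $f$ is large, and strongly large if both $f$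 and $g$ are large. Corollary 4.1. (i) If the gluing $(\mathcal V,v)$ is large, then $$\operatorname{edim}(\mathcal V)=\frac{1}{\beta_1^{X}(Z)}\left[\frac{\beta_1^{\mathcal V}(Y)\left(\operatorname{edim}(X)\,\beta_1^{X}(Z)-\beta_2^{X}(Z)\right)}{\beta_1^{X}(Z)}+\beta_2^{\mathcal V}(Y)\right].$$ (ii) Suppose that the gluing $(\mathcal V,v)$ satisfies one of the following conditions: (a) it is weakly large and there is a surjective ring homomorphism $\varphi:\mathcal O_{Y,y}\to\mathcal O_{X,x}$ with $\alpha^*\circ\varphi=\beta^*$; (b) it is strongly large. Then $\operatorname{edim}(\mathcal V)=\beta_1^{X}(Z)+\operatorname{edim}(Y)$. -/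

import Mathlib

open CategoryTheory Filter Topology

noncomputable section

namespace AnalyticGerm

/-! ### Germs of holomorphic functions on `ℂⁿ` -/

instance germAlgebra {n : ℕ} (p : Fin n → ℂ) : Algebra ℂ (Germ (𝓝 p) ℂ) :=
  Algebra.ofModule
    (fun c a b => by
      induction a, b using Germ.inductionOn₂ with
      | _ a b => exact congrArg _ (smul_mul_assoc c a b))
    (fun c a b => by
      induction a, b using Germ.inductionOn₂ with
      | _ a b => exact congrArg _ (mul_smul_comm c a b))

/-- The local ring `𝓞_{ℂⁿ,p}` of germs at `p` of holomorphic functions, as a subalgebra of the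
algebra of germs at `p` of all complex valued functions. -/
def holGerm {n : ℕ} (p : Fin n → ℂ) : Subalgebra ℂ (Germ (𝓝 p) ℂ) where
  carrier := {F | ∃ f : (Fin n → ℂ) → ℂ, AnalyticAt ℂ f p ∧ F = (f : Germ (𝓝 p) ℂ)}
  mul_mem' := by
    rintro _ _ ⟨f, hf, rfl⟩ ⟨g, hg, rfl⟩
    exact ⟨f * g, hf.mul hg, rfl⟩
  add_mem' := by
    rintro _ _ ⟨f, hf, rfl⟩ ⟨g, hg, rfl⟩
    exact ⟨f + g, hf.add hg, rfl⟩
  algebraMap_mem' := fun c => ⟨fun _ => c, analyticAt_const, by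
    rw [Algebra.algebraMap_eq_smul_one]
    refine congrArg _ (funext fun _ => ?_)
    simp⟩

/-- The germ at `p` of a function that is holomorphic near `p`. -/
def holGerm.mk {n : ℕ} {p : Fin n → ℂ} (f : (Fin n → ℂ) → ℂ) (hf : AnalyticAt ℂ f p) :
    holGerm p :=
  ⟨(f : Germ (𝓝 p) ℂ), f, hf, rfl⟩

instance {n : ℕ} (p : Fin n → ℂ) : Nontrivial (holGerm p) := by
  refine ⟨0, 1, fun h => ?_⟩
  have h1 : (0 : Germ (𝓝 p) ℂ) = 1 := congrArg Subtype.val h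
  exact zero_ne_one (congrArg Germ.value h1)

instance {n : ℕ} (p : Fin n → ℂ) : IsLocalRing (holGerm p) := by
  have key : ∀ F : holGerm p, Germ.value F.1 ≠ 0 → IsUnit F := by
    rintro ⟨_, f, hf, rfl⟩ h0
    have h0 : f p ≠ 0 := h0
    refine IsUnit.of_mul_eq_one (holGerm.mk f⁻¹ (hf.inv h0)) (Subtype.ext (Germ.coe_eq.2 ?_))
    filter_upwards [hf.continuousAt.eventually_ne h0] with q hq
    exact mul_inv_cancel₀ hq
  refine IsLocalRing.of_isUnit_or_isUnit_one_sub_self fun F => ?_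
  by_cases h : Germ.value F.1 = 0
  · right
    refine key _ ?_
    have h1 : Germ.value (1 - F : holGerm p).1 = 1 - Germ.value F.1 :=
      map_sub (Germ.valueRingHom (X := Fin n → ℂ) (E := ℂ) (x := p)) 1 F.1
    rw [h1, h]
    simp
  · exact Or.inl (key F h)

/-- Pull-back `f ↦ f ∘ φ` of germs of holomorphic functions along a map `φ` which is holomorphic
near `z` and sends `z` to `x`. -/
def holGerm.pullback {l n : ℕ} {z : Fin l → ℂ} {x : Fin n → ℂ} (φ : (Fin l → ℂ) → (Fin n → ℂ))
    (hφ : AnalyticAt ℂ φ z) (hz : φ z = x) : holGerm x →ₐ[ℂ] holGerm z where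
  toFun F := ⟨F.1.compTendsto φ (by rw [← hz]; exact hφ.continuousAt), by
    obtain ⟨_, f, hf, rfl⟩ := F
    exact ⟨f ∘ φ, AnalyticAt.comp (by rw [hz]; exact hf) hφ, rfl⟩⟩
  map_one' := rfl
  map_zero' := rfl
  map_mul' := by rintro ⟨_, f, hf, rfl⟩ ⟨_, g, hg, rfl⟩; rfl
  map_add' := by rintro ⟨_, f, hf, rfl⟩ ⟨_, g, hg, rfl⟩; rfl
  commutes' := fun c => by
    refine Subtype.ext ?_
    simp only [Algebra.algebraMap_eq_smul_one]
    rfl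

theorem holGerm.pullback_comp {k l n : ℕ} {w : Fin k → ℂ} {z : Fin l → ℂ} {x : Fin n → ℂ}
    (ψ : (Fin k → ℂ) → (Fin l → ℂ)) (hψ : AnalyticAt ℂ ψ w) (hw : ψ w = z)
    (φ : (Fin l → ℂ) → (Fin n → ℂ)) (hφ : AnalyticAt ℂ φ z) (hz : φ z = x) (h) (h')
    (F : holGerm x) :
    holGerm.pullback ψ hψ hw (holGerm.pullback φ hφ hz F) =
      holGerm.pullback (φ ∘ ψ) h h' F := by
  obtain ⟨_, f, hf, rfl⟩ := F
  rfl

theorem holGerm.pullback_id {n : ℕ} {x : Fin n → ℂ} (h) (h') (F : holGerm x) :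
    holGerm.pullback id h h' F = F := by
  obtain ⟨_, f, hf, rfl⟩ := F
  rfl

end AnalyticGerm

open AnalyticGerm

/-! ### Germs of complex analytic spaces -/

/-- A germ `(X, x) ⊂ (ℂⁿ, x)` of a complex analytic space, given by a proper ideal of
`𝓞_{ℂⁿ,x}`. The ideal need not be radical: `(X, x)` may be non-reduced. -/
structure AnalyticGerm where
  ambDim : ℕ
  pt : Fin ambDim → ℂ
  ideal : Ideal (holGerm pt)
  ideal_ne_top : ideal ≠ ⊤

namespace AnalyticGerm

/-- The local ring `𝓞_{X,x} = 𝓞_{ℂⁿ,x} / I_{X,x}`. -/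
def stalk (X : AnalyticGerm) : Type := holGerm X.pt ⧸ X.ideal

instance (X : AnalyticGerm) : CommRing X.stalk :=
  inferInstanceAs (CommRing (holGerm X.pt ⧸ X.ideal))

instance (X : AnalyticGerm) : Algebra ℂ X.stalk :=
  inferInstanceAs (Algebra ℂ (holGerm X.pt ⧸ X.ideal))

/-- The quotient map `𝓞_{ℂⁿ,x} → 𝓞_{X,x}`. -/
def toStalk (X : AnalyticGerm) : holGerm X.pt →ₐ[ℂ] X.stalk := Ideal.Quotient.mkₐ ℂ X.ideal

instance (X : AnalyticGerm) : Nontrivial X.stalk := Ideal.Quotient.nontrivial_iff.2 X.ideal_ne_top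

instance (X : AnalyticGerm) : IsLocalRing X.stalk :=
  IsLocalRing.of_surjective' X.toStalk.toRingHom Ideal.Quotient.mk_surjective

/-- A morphism of germs `(Z, z) ⟶ (X, x)`: a homomorphism `𝓞_{X,x} → 𝓞_{Z,z}` that is induced by
the germ of a holomorphic map of the ambient spaces. Two holomorphic maps with the same
comorphism define the same morphism. -/
@[ext]
structure Hom (Z X : AnalyticGerm) where
  comorphism : X.stalk →ₐ[ℂ] Z.stalk
  exists_map : ∃ (φ : (Fin Z.ambDim → ℂ) → (Fin X.ambDim → ℂ)) (hφ : AnalyticAt ℂ φ Z.pt)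
    (hz : φ Z.pt = X.pt), ∀ F : holGerm X.pt,
      comorphism (X.toStalk F) =
        Z.toStalk (holGerm.pullback φ hφ hz F)

/-- The category of germs of complex analytic spaces. -/
instance : Category AnalyticGerm where
  Hom := Hom
  id X := ⟨AlgHom.id ℂ X.stalk, id, analyticAt_id, rfl, fun F => by
    rw [holGerm.pullback_id]; rfl⟩
  comp {W Z X} u v := ⟨u.comorphism.comp v.comorphism, by
    obtain ⟨ψ, hψ, hw, hu⟩ := u.exists_map
    obtain ⟨φ, hφ, hz, hv⟩ := v.exists_map
    refine ⟨φ ∘ ψ, AnalyticAt.comp (by rw [hw]; exact hφ) hψ, by simp [hw, hz], fun F => ?_⟩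
    rw [AlgHom.comp_apply, hv, hu, holGerm.pullback_comp]⟩

/-- The induced homomorphism `u^* : 𝓞_{X,x} → 𝓞_{Z,z}` of a morphism `u : (Z, z) ⟶ (X, x)`. -/
def comap {Z X : AnalyticGerm} (u : Z ⟶ X) : X.stalk →ₐ[ℂ] Z.stalk := Hom.comorphism u

/-- The embedding dimension, `dim 𝔪 / 𝔪²`. -/
def edim (X : AnalyticGerm) : ℕ :=
  Module.finrank (IsLocalRing.ResidueField X.stalk) (IsLocalRing.CotangentSpace X.stalk)

/-- The `i`-th Betti number `dim_ℂ Tor_i(M, ℂ)` of an `𝓞_{X,x}`-module `M`, where `ℂ` is the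
residue field of `𝓞_{X,x}`. -/
def betti (X : AnalyticGerm) (M : ModuleCat.{0} X.stalk) (i : ℕ) : ℕ :=
  Module.finrank ℂ (RestrictScalars ℂ X.stalk
    (((Tor (ModuleCat.{0} X.stalk) i).obj M).obj
      (ModuleCat.of X.stalk (IsLocalRing.ResidueField X.stalk))))

/-- The Poincaré series `P_M^{𝓞_{X,x}}(t)`. -/
def poincare (X : AnalyticGerm) (M : ModuleCat.{0} X.stalk) : PowerSeries ℕ :=
  PowerSeries.mk fun i => X.betti M i

/-- An `𝓞_{Y,y}`-module, viewed as an `𝓞_{X,x}`-module along `u^* : 𝓞_{X,x} → 𝓞_{Y,y}`. -/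
abbrev viaComap {Y X : AnalyticGerm} (u : Y ⟶ X) (M : ModuleCat.{0} Y.stalk) :
    ModuleCat.{0} X.stalk :=
  (ModuleCat.restrictScalars (comap u).toRingHom).obj M

/-- The structure ring `𝓞_{Y,y}` as a module over itself. -/
abbrev self (Y : AnalyticGerm) : ModuleCat.{0} Y.stalk := ModuleCat.of Y.stalk Y.stalk

/-- The Betti number `β_i^X(Y)` of `(Y, y)` regarded as a subspace of `(X, x)` through
`u : (Y, y) ⟶ (X, x)`, i.e. of `𝓞_{Y,y}` as an `𝓞_{X,x}`-module. -/
def relBetti {Y X : AnalyticGerm} (u : Y ⟶ X) (i : ℕ) : ℕ := X.betti (viaComap u Y.self) i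

/-- `f : (Y, y) ⟶ (X, x)` with `f^*` surjective is large if `P_Z^X = P_Z^Y P_Y^X` for every
subspace `(Z, z)` of `(Y, y)`, defined by a reduced ideal `I` of `𝓞_{Y,y}`. -/
def IsLarge {Y X : AnalyticGerm} (f : Y ⟶ X) : Prop :=
  Function.Surjective (comap f) ∧
    ∀ I : Ideal Y.stalk, I ≠ ⊤ → I.IsRadical →
      X.poincare (viaComap f (ModuleCat.of Y.stalk (Y.stalk ⧸ I))) =
        Y.poincare (ModuleCat.of Y.stalk (Y.stalk ⧸ I)) * X.poincare (viaComap f Y.self)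

/-- The gluing of `(X, x)` and `(Y, y)` along `(Z, z)`, with `α : Z ⟶ X` and `f : X ⟶ V` the
natural map to the gluing, is weakly large if `P_K^V = P_K^X P_X^V`, where `K` is the kernel
of `α^*`, regarded as an `𝓞_{X,x}`-module. -/
def IsWeaklyLarge {X Z V : AnalyticGerm} (α : Z ⟶ X) (f : X ⟶ V) : Prop :=
  V.poincare (viaComap f (ModuleCat.of X.stalk (RingHom.ker (comap α)))) =
    X.poincare (ModuleCat.of X.stalk (RingHom.ker (comap α))) * V.poincare (viaComap f X.self)

end AnalyticGerm

end

/-! Write `K = ker α^*` and `b = β_1^X(Z)`. The gluing has local ring `𝓞_X ×_{𝓞_Z} 𝓞_Y`: morphisms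
from a germ `W` to the complex line are the same as elements of `𝔪_W`, so the universal property of
the pushout, tested on the line, computes the ring (`exists_of_isPushout`, `eq_zero_of_isPushout`).
Consequently `f^*` and `g^*` are surjective, and `f^*` maps `ker g^*` isomorphically onto `K`
(`exists_kerEquiv`). Counting generators gives `β_1^V(Y) = b` (`relBetti_one_right`).

If `u : Y ⟶ X` is large, test the definition on the reduced point and compare coefficients of `t`:
`edim X = edim Y + β_1^X(Y)` (`edim_of_isLarge`). Applied to `g`, this is case (b) of (ii).

For (i), apply it to `f`. The equality `edim V = edim X + β_1^V(X)` says that the sequence of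
cotangent spaces of `ker f^* → 𝔪_V → 𝔪_X` is exact on the left, that is, `ker f^* ∩ 𝔪_V² = 𝔪_V ker
f^*`. This suffices to compare first syzygies over `𝓞_V` and `𝓞_X` (`betti_one_of_large`), and for
the module `K` it yields `β_2^V(Y) = β_2^X(Z) + b β_1^V(X)` (`relBetti_two_right`). The right-hand
side of the formula then collapses to `edim X + β_1^V(X)`. Division by `b` is legitimate by
Nakayama, since `K ≠ 0`.

In case (a) of (ii), `δ = f^* - φ g^*` takes values in `K` and satisfies a product rule, so it sends
`𝔪_V²` into `𝔪_X K`; on `ker g^*` it is the isomorphism with `K`. Hence `ker g^* ∩ 𝔪_V² = 𝔪_V ker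
g^*`, and the cotangent spaces of `ker g^* → 𝔪_V → 𝔪_Y` give the count (`edim_of_factor`).

Nakayama, Krull's intersection theorem and all dimension counts require `𝓞_{ℂⁿ,p}` to be Noetherian.
This is proved by division with respect to leading monomials in the ring of convergent power series,
which maps onto `𝓞_{ℂⁿ,p}`. -/

noncomputable section

/-! ### Convergent power series -/

namespace ConvergentPowerSeries

open Finset

variable {n : ℕ}

/-- The number `∏ pᵢ ^ νᵢ`, where `pᵢ` is the `i`-th prime number. It orders the monomials in `n`
variables in a multiplicative way. -/
def size (ν : Fin n →₀ ℕ) : ℕ := ∏ i : Fin n, Nat.nth Nat.Prime i ^ ν i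

theorem size_add (ν μ : Fin n →₀ ℕ) : size (ν + μ) = size ν * size μ := by
  simp [size, pow_add, prod_mul_distrib]

theorem size_pos (ν : Fin n →₀ ℕ) : 0 < size ν :=
  prod_pos fun i _ => pow_pos (Nat.prime_nth_prime i).pos _

/-- Unique factorization: `ν j` is the multiplicity of the `j`-th prime. Thus `size` gives a total
order on monomials with finite initial segments. -/
theorem size_injective : Function.Injective (size (n := n)) := by
  have key : ∀ (ν : Fin n →₀ ℕ) (j : Fin n),
      (size ν).factorization (Nat.nth Nat.Prime j) = ν j := by
    intro ν j
    rw [size, Nat.factorization_prod (S := univ) (g := fun i : Fin n => Nat.nth Nat.Prime i ^ ν i)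
        fun i _ => pow_ne_zero _ (Nat.prime_nth_prime i).ne_zero,
      Finsupp.finsetSum_apply, sum_eq_single j]
    · simp
    · intro i _ hij
      have : Nat.nth Nat.Prime i ≠ Nat.nth Nat.Prime j := fun h =>
        hij (Fin.ext (Nat.nth_injective Nat.infinite_setOfPred_prime h))
      simp [this]
    · simp
  intro ν μ h
  ext j
  rw [← key ν j, ← key μ j, h]

theorem size_lt_of_add {ν κ τ : Fin n →₀ ℕ} (h : size ν < size τ) :
    size (κ + ν) < size (κ + τ) := by
  rw [size_add, size_add]
  exact Nat.mul_lt_mul_of_pos_left h (size_pos κ)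

open scoped ENNReal

/-- The value of the monomial with exponent `ν` at the point with coordinates `pᵢ⁻ˢ`. -/
def wt (s : ℕ) (ν : Fin n →₀ ℕ) : ℝ≥0∞ := ((size ν : ℝ≥0∞)⁻¹) ^ s

theorem wt_add (s : ℕ) (ν μ : Fin n →₀ ℕ) : wt s (ν + μ) = wt s ν * wt s μ := by
  simp only [wt, size_add, Nat.cast_mul]
  rw [ENNReal.mul_inv (Or.inr (ENNReal.natCast_ne_top _)) (Or.inl (ENNReal.natCast_ne_top _)),
    mul_pow]

theorem inv_size_le_one (ν : Fin n →₀ ℕ) : (size ν : ℝ≥0∞)⁻¹ ≤ 1 :=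
  ENNReal.inv_le_one.2 (by exact_mod_cast size_pos ν)

theorem wt_ne_top (s : ℕ) (ν : Fin n →₀ ℕ) : wt s ν ≠ ∞ :=
  ne_top_of_le_ne_top ENNReal.one_ne_top (pow_le_one₀ zero_le (inv_size_le_one ν))

theorem wt_ne_zero (s : ℕ) (ν : Fin n →₀ ℕ) : wt s ν ≠ 0 :=
  pow_ne_zero _ (ENNReal.inv_ne_zero.2 (ENNReal.natCast_ne_top _))

theorem wt_antitone {s t : ℕ} (h : s ≤ t) (ν : Fin n →₀ ℕ) : wt t ν ≤ wt s ν :=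
  pow_le_pow_of_le_one zero_le (inv_size_le_one ν) h

open MvPowerSeries

/-- The weighted `ℓ¹`-norm of a power series, on the polydisc with radii `pᵢ⁻ˢ`. -/
def nrm (s : ℕ) (G : MvPowerSeries (Fin n) ℂ) : ℝ≥0∞ := ∑' ν, ‖coeff ν G‖ₑ * wt s ν

theorem nrm_antitone {s t : ℕ} (h : s ≤ t) (G : MvPowerSeries (Fin n) ℂ) : nrm t G ≤ nrm s G :=
  ENNReal.tsum_le_tsum fun ν => by gcongr; exact wt_antitone h ν

theorem nrm_add_le (s : ℕ) (G H : MvPowerSeries (Fin n) ℂ) :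
    nrm s (G + H) ≤ nrm s G + nrm s H := by
  rw [nrm, nrm, nrm, ← ENNReal.tsum_add]
  refine ENNReal.tsum_le_tsum fun ν => ?_
  rw [← add_mul, map_add]
  gcongr
  exact enorm_add_le _ _

theorem nrm_neg (s : ℕ) (G : MvPowerSeries (Fin n) ℂ) : nrm s (-G) = nrm s G := by
  simp [nrm]

theorem nrm_zero (s : ℕ) : nrm s (0 : MvPowerSeries (Fin n) ℂ) = 0 := by
  simp [nrm]

theorem nrm_sub_le (s : ℕ) (G H : MvPowerSeries (Fin n) ℂ) :
    nrm s (G - H) ≤ nrm s G + nrm s H := by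
  rw [sub_eq_add_neg, ← nrm_neg s H]
  exact nrm_add_le s _ _

theorem nrm_sum_le (s : ℕ) {ι : Type*} (F : Finset ι) (G : ι → MvPowerSeries (Fin n) ℂ) :
    nrm s (∑ i ∈ F, G i) ≤ ∑ i ∈ F, nrm s (G i) :=
  le_sum_of_subadditive _ (nrm_zero s).le (nrm_add_le s) _ _

theorem nrm_mul_le (s : ℕ) (G H : MvPowerSeries (Fin n) ℂ) :
    nrm s (G * H) ≤ nrm s G * nrm s H := by
  calc nrm s (G * H)
      ≤ ∑' ν, ∑ p ∈ antidiagonal ν,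
          (‖coeff p.1 G‖ₑ * wt s p.1) * (‖coeff p.2 H‖ₑ * wt s p.2) := by
        refine ENNReal.tsum_le_tsum fun ν => ?_
        rw [coeff_mul]
        calc _ ≤ (∑ p ∈ antidiagonal ν, ‖coeff p.1 G * coeff p.2 H‖ₑ) * wt s ν := by
              gcongr; exact enorm_sum_le _ _
          _ = _ := by
              rw [sum_mul]
              refine sum_congr rfl fun p hp => ?_
              rw [← mem_antidiagonal.1 hp, wt_add, enorm_mul]
              ring
    _ = nrm s G * nrm s H := by
        rw [nrm, ← ENNReal.tsum_mul_right]
        simp_rw [nrm, ← ENNReal.tsum_mul_left]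
        rw [← ENNReal.tsum_prod, ← HasAntidiagonal.sigmaAntidiagonalEquivProd.tsum_eq, ENNReal.tsum_sigma']
        refine tsum_congr fun ν => ?_
        rw [tsum_fintype, ← sum_coe_sort]
        rfl

theorem nrm_monomial (s : ℕ) (ν : Fin n →₀ ℕ) (c : ℂ) : nrm s (monomial ν c) = ‖c‖ₑ * wt s ν := by
  classical
  rw [nrm, tsum_eq_single ν]
  · simp
  · intro μ hμ
    simp [coeff_monomial, hμ]

/-- The ring of convergent power series in `n` variables. -/
def convergent (n : ℕ) : Subring (MvPowerSeries (Fin n) ℂ) where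
  carrier := {G | ∃ s, nrm s G ≠ ∞}
  zero_mem' := ⟨0, by simp [nrm_zero]⟩
  one_mem' := ⟨0, by
    rw [← monomial_zero_one, nrm_monomial]
    exact ENNReal.mul_ne_top enorm_ne_top (wt_ne_top _ _)⟩
  neg_mem' := fun ⟨s, hs⟩ => ⟨s, by rwa [nrm_neg]⟩
  add_mem' := fun {G H} ⟨s, hs⟩ ⟨t, ht⟩ => ⟨max s t, ne_top_of_le_ne_top
    (ENNReal.add_ne_top.2 ⟨ne_top_of_le_ne_top hs (nrm_antitone (le_max_left s t) G),
      ne_top_of_le_ne_top ht (nrm_antitone (le_max_right s t) H)⟩) (nrm_add_le _ _ _)⟩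
  mul_mem' := fun {G H} ⟨s, hs⟩ ⟨t, ht⟩ => ⟨max s t, ne_top_of_le_ne_top
    (ENNReal.mul_ne_top (ne_top_of_le_ne_top hs (nrm_antitone (le_max_left s t) G))
      (ne_top_of_le_ne_top ht (nrm_antitone (le_max_right s t) H))) (nrm_mul_le _ _ _)⟩

theorem monomial_mem (ν : Fin n →₀ ℕ) (c : ℂ) : monomial ν c ∈ convergent n :=
  ⟨0, by rw [nrm_monomial]; exact ENNReal.mul_ne_top enorm_ne_top (wt_ne_top _ _)⟩

/-- A power series whose terms are all larger than `ν` is small compared with the monomial `ν` on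
small polydiscs. -/
theorem eventually_nrm_le {h : MvPowerSeries (Fin n) ℂ} (hh : h ∈ convergent n) {ν : Fin n →₀ ℕ}
    (hν : ∀ τ, coeff τ h ≠ 0 → size ν < size τ) {ε : ℝ≥0∞} (hε : ε ≠ 0) :
    ∀ᶠ s in atTop, nrm s h ≤ ε * wt s ν := by
  obtain ⟨s₀, hs₀⟩ := hh
  set N : ℝ≥0∞ := (size ν : ℝ≥0∞) with hN
  have hN0 : N ≠ 0 := by simpa [hN] using (size_pos ν).ne'
  have hNt : N ≠ ∞ := ENNReal.natCast_ne_top _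
  -- Sizes are integers, so every exponent of `h` has size at least `N + 1`. Raising `s` by one
  -- shrinks `nrm s h` by at least the factor `(N + 1)⁻¹`, but `wt s ν` only by `N⁻¹`; the ratio of
  -- the two is below 1.
  have h1 : ∀ k, nrm (s₀ + k) h ≤ ((N + 1)⁻¹) ^ k * nrm s₀ h := by
    intro k
    rw [nrm, nrm, ← ENNReal.tsum_mul_left]
    refine ENNReal.tsum_le_tsum fun τ => ?_
    by_cases hτ : coeff τ h = 0
    · simp [hτ]
    · rw [wt, pow_add, ← wt]
      have : (size τ : ℝ≥0∞)⁻¹ ≤ (N + 1)⁻¹ := by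
        rw [ENNReal.inv_le_inv, hN]
        exact_mod_cast hν τ hτ
      calc ‖coeff τ h‖ₑ * (wt s₀ τ * (size τ : ℝ≥0∞)⁻¹ ^ k)
          ≤ ‖coeff τ h‖ₑ * (wt s₀ τ * (N + 1)⁻¹ ^ k) := by gcongr
        _ = _ := by ring
  have hr : N * (N + 1)⁻¹ < 1 := by
    rw [← div_eq_mul_inv]
    refine ENNReal.div_lt_of_lt_mul ?_
    rw [one_mul]
    exact ENNReal.lt_add_right hNt one_ne_zero
  have h2 : Tendsto (fun k => (N * (N + 1)⁻¹) ^ k * (nrm s₀ h * N ^ s₀)) atTop (𝓝 0) := by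
    have := ENNReal.Tendsto.mul_const (b := nrm s₀ h * N ^ s₀)
      (ENNReal.tendsto_pow_atTop_nhds_zero_of_lt_one hr)
      (Or.inr (ENNReal.mul_ne_top hs₀ (ENNReal.pow_ne_top hNt)))
    simpa using this
  obtain ⟨k₀, hk₀⟩ := eventually_atTop.1 (h2.eventually_le_const (pos_iff_ne_zero.2 hε))
  refine eventually_atTop.2 ⟨s₀ + k₀, fun s hs => ?_⟩
  obtain ⟨k, rfl⟩ := Nat.exists_eq_add_of_le (le_of_add_le_left hs)
  have hk : k₀ ≤ k := by omega
  have hNN : N * N⁻¹ = 1 := ENNReal.mul_inv_cancel hN0 hNt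
  calc nrm (s₀ + k) h ≤ ((N + 1)⁻¹) ^ k * nrm s₀ h := h1 k
    _ = ((N * (N + 1)⁻¹) ^ k * (nrm s₀ h * N ^ s₀)) * wt (s₀ + k) ν := by
        rw [wt, ← hN, pow_add, mul_pow]
        calc _ = (N * N⁻¹) ^ s₀ * (N * N⁻¹) ^ k * (((N + 1)⁻¹) ^ k * nrm s₀ h) := by
              rw [hNN]; simp
          _ = _ := by rw [mul_pow, mul_pow]; ring
    _ ≤ ε * wt (s₀ + k) ν := by gcongr; exact hk₀ k hk

/-- The part of `G` consisting of the terms assigned to `ν` by `c`, divided by the monomial `ν`. -/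
def part (c : (Fin n →₀ ℕ) → (Fin n →₀ ℕ)) (ν : Fin n →₀ ℕ) (G : MvPowerSeries (Fin n) ℂ) :
    MvPowerSeries (Fin n) ℂ :=
  open Classical in fun κ => if c (κ + ν) = ν then coeff (κ + ν) G else 0

theorem coeff_part (c : (Fin n →₀ ℕ) → (Fin n →₀ ℕ)) (ν κ : Fin n →₀ ℕ)
    (G : MvPowerSeries (Fin n) ℂ) [Decidable (c (κ + ν) = ν)] :
    coeff κ (part c ν G) = if c (κ + ν) = ν then coeff (κ + ν) G else 0 := by
  rw [coeff_apply, part]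
  congr

theorem wt_mul_nrm_part_le (s : ℕ) (c : (Fin n →₀ ℕ) → (Fin n →₀ ℕ)) (ν : Fin n →₀ ℕ)
    (G : MvPowerSeries (Fin n) ℂ) : wt s ν * nrm s (part c ν G) ≤ nrm s G := by
  classical
  calc wt s ν * nrm s (part c ν G)
      ≤ ∑' κ, ‖coeff (κ + ν) G‖ₑ * wt s (κ + ν) := by
        rw [nrm, ← ENNReal.tsum_mul_left]
        refine ENNReal.tsum_le_tsum fun κ => ?_
        rw [coeff_part, wt_add]
        split_ifs
        · exact le_of_eq (by ring)
        · simp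
    _ ≤ nrm s G := ENNReal.tsum_comp_le_tsum_of_injective (add_left_injective ν)
        (fun μ => ‖coeff μ G‖ₑ * wt s μ)

/-! ### Division by series with prescribed leading monomials, with norm estimates -/

section Division

variable (F : Finset (Fin n →₀ ℕ)) (c : (Fin n →₀ ℕ) → (Fin n →₀ ℕ))
  (h : (Fin n →₀ ℕ) → MvPowerSeries (Fin n) ℂ) (g : MvPowerSeries (Fin n) ℂ)

open Classical in
/-- The solution `G` of `G + ∑ (part c ν G) * h ν = g`, defined by recursion on the size. -/
def solution (μ : Fin n →₀ ℕ) : ℂ :=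
  coeff μ g - ∑ ν ∈ F, ∑ p ∈ antidiagonal μ,
    (if _ : c (p.1 + ν) = ν ∧ size (p.1 + ν) < size μ then solution (p.1 + ν) else 0) *
      coeff p.2 (h ν)
termination_by size μ
decreasing_by exact (by assumption : _ ∧ _).2

variable {F h}

theorem solution_add_sum (hF : ∀ ν ∈ F, ∀ τ, coeff τ (h ν) ≠ 0 → size ν < size τ) :
    (show MvPowerSeries (Fin n) ℂ from solution F c h g) +
      ∑ ν ∈ F, part c ν (solution F c h g) * h ν = g := by
  classical
  ext μ
  rw [map_add, map_sum, coeff_apply, solution]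
  -- The size guard in `solution` only serves termination: a nonzero coefficient of `h ν` at `p.2`
  -- forces `size ν < size p.2`, hence `size (p.1 + ν) < size μ`.
  have : ∀ ν ∈ F, ∀ p ∈ antidiagonal μ,
      (if hlt : c (p.1 + ν) = ν ∧ size (p.1 + ν) < size μ then solution F c h g (p.1 + ν) else 0) *
        coeff p.2 (h ν) = coeff p.1 (part c ν (solution F c h g)) * coeff p.2 (h ν) := by
    intro ν hν p hp
    by_cases h0 : coeff p.2 (h ν) = 0
    · simp [h0]
    · have : size (p.1 + ν) < size μ := by
        rw [← mem_antidiagonal.1 hp]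
        exact size_lt_of_add (hF ν hν _ h0)
      simp only [this, and_true]
      rfl
  rw [sum_congr rfl fun ν hν => sum_congr rfl (this ν hν)]
  simp only [coeff_mul]
  ring

/-- The terms of `G` of size at most `k`. -/
def cut (k : ℕ) (G : MvPowerSeries (Fin n) ℂ) : MvPowerSeries (Fin n) ℂ :=
  fun μ => if size μ ≤ k then coeff μ G else 0

theorem coeff_cut (k : ℕ) (G : MvPowerSeries (Fin n) ℂ) (μ : Fin n →₀ ℕ) :
    coeff μ (cut k G) = if size μ ≤ k then coeff μ G else 0 := rfl

theorem nrm_cut_le (s k : ℕ) (G : MvPowerSeries (Fin n) ℂ) : nrm s (cut k G) ≤ nrm s G :=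
  ENNReal.tsum_le_tsum fun ν => by
    rw [coeff_cut]
    split_ifs <;> simp

theorem nrm_cut_ne_top (s k : ℕ) (G : MvPowerSeries (Fin n) ℂ) : nrm s (cut k G) ≠ ∞ := by
  have hfin : {ν : Fin n →₀ ℕ | size ν ≤ k}.Finite :=
    (Set.finite_Iic k).preimage size_injective.injOn
  rw [nrm, tsum_eq_sum (s := hfin.toFinset)]
  · exact ENNReal.sum_ne_top.2 fun ν _ => ENNReal.mul_ne_top enorm_ne_top (wt_ne_top _ _)
  · intro ν hν
    have : ¬ size ν ≤ k := by simpa using hν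
    simp [coeff_cut, this]

theorem nrm_le_of_cut_le {s : ℕ} {G : MvPowerSeries (Fin n) ℂ} {A : ℝ≥0∞}
    (hA : ∀ k, nrm s (cut k G) ≤ A) : nrm s G ≤ A := by
  rw [nrm, ENNReal.tsum_eq_iSup_sum]
  refine iSup_le fun t => ?_
  refine le_trans ?_ (hA (t.sup size))
  refine le_trans (le_of_eq ?_) (ENNReal.sum_le_tsum t)
  refine sum_congr rfl fun ν hν => ?_
  rw [coeff_cut, if_pos (le_sup hν)]

/-- The constant `(2 * #F)⁻¹` makes `G ↦ ∑ part c ν G * h ν` a contraction by one half, so `nrm s G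
≤ nrm s g + nrm s G / 2`. Cancelling the last term needs a finite norm, so the estimate is made for
the truncations `cut k G`, uniformly in `k`. -/
theorem nrm_solution_le (hF : ∀ ν ∈ F, ∀ τ, coeff τ (h ν) ≠ 0 → size ν < size τ) {s : ℕ}
    (hs : ∀ ν ∈ F, nrm s (h ν) ≤ (2 * #F : ℝ≥0∞)⁻¹ * wt s ν) :
    nrm s (solution F c h g) ≤ 2 * nrm s g := by
  classical
  set G : MvPowerSeries (Fin n) ℂ := solution F c h g with hG
  refine nrm_le_of_cut_le fun k => ?_
  -- Multiplication by `h ν` raises sizes beyond that of `ν`, so terms of size at most `k` in the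
  -- sum only involve terms of size at most `k` of `G`.
  have hcut : cut k G = cut k (g - ∑ ν ∈ F, part c ν (cut k G) * h ν) := by
    ext μ
    simp only [coeff_cut]
    split_ifs with hμ
    · rw [← solution_add_sum c g hF, ← hG]
      simp only [map_sub, map_add, map_sum, coeff_mul]
      rw [eq_comm, add_sub_assoc, add_eq_left, sub_eq_zero]
      refine sum_congr rfl fun ν hν => sum_congr rfl fun p hp => ?_
      by_cases h0 : coeff p.2 (h ν) = 0
      · simp [h0]
      · have : size (p.1 + ν) ≤ k := by
          refine le_trans (le_of_lt ?_) hμ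
          rw [← mem_antidiagonal.1 hp]
          exact size_lt_of_add (hF ν hν _ h0)
        rw [coeff_part, coeff_part, coeff_cut, if_pos this]
    · rfl
  have hle : nrm s (cut k G) ≤ nrm s g + 2⁻¹ * nrm s (cut k G) := by
    calc nrm s (cut k G)
        ≤ nrm s g + ∑ ν ∈ F, nrm s (part c ν (cut k G) * h ν) := by
          conv_lhs => rw [hcut]
          refine (nrm_cut_le _ _ _).trans ((nrm_sub_le _ _ _).trans ?_)
          gcongr
          exact nrm_sum_le _ _ _
      _ ≤ nrm s g + ∑ ν ∈ F, (2 * #F : ℝ≥0∞)⁻¹ * nrm s (cut k G) := by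
          gcongr with ν hν
          calc nrm s (part c ν (cut k G) * h ν)
              ≤ nrm s (part c ν (cut k G)) * ((2 * #F : ℝ≥0∞)⁻¹ * wt s ν) := by
                refine (nrm_mul_le _ _ _).trans ?_
                gcongr
                exact hs ν hν
            _ = (2 * #F : ℝ≥0∞)⁻¹ * (wt s ν * nrm s (part c ν (cut k G))) := by ring
            _ ≤ _ := by gcongr; exact wt_mul_nrm_part_le _ _ _ _
      _ ≤ _ := by
          gcongr
          rw [sum_const, nsmul_eq_mul, ← mul_assoc]
          gcongr
          -- Only an inequality is available for empty `F`, where `(#F)⁻¹ * #F = ∞ * 0 = 0`.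
          rw [ENNReal.mul_inv (by simp) (by simp), mul_comm, mul_assoc]
          refine mul_le_of_le_one_right zero_le ?_
          exact ENNReal.inv_mul_le_one _
  have hfin : 2⁻¹ * nrm s (cut k G) ≠ ∞ :=
    ENNReal.mul_ne_top (by simp) (nrm_cut_ne_top s k G)
  have hsplit : nrm s (cut k G) = 2⁻¹ * nrm s (cut k G) + 2⁻¹ * nrm s (cut k G) := by
    rw [← add_mul, ENNReal.inv_two_add_inv_two, one_mul]
  have h3 : 2⁻¹ * nrm s (cut k G) ≤ nrm s g := by
    refine (ENNReal.add_le_add_iff_right hfin).1 ?_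
    rw [← hsplit]
    exact hle
  calc nrm s (cut k G) = 2 * (2⁻¹ * nrm s (cut k G)) := by
        rw [← mul_assoc, ENNReal.mul_inv_cancel (by simp) (by simp), one_mul]
    _ ≤ _ := by gcongr

end Division

/-- The exponents of the leading terms of the elements of an ideal. -/
def leading (I : Ideal (convergent n)) : Set (Fin n →₀ ℕ) :=
  {ν | ∃ a ∈ I, coeff ν a.1 = 1 ∧ ∀ τ, coeff τ a.1 ≠ 0 → size ν ≤ size τ}

theorem exists_le_of_mem {I : Ideal (convergent n)} {a : convergent n} (ha : a ∈ I)
    (h0 : a ≠ 0) : ∃ ν ∈ leading I, coeff ν a.1 ≠ 0 := by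
  have hne : {ν | coeff ν a.1 ≠ 0}.Nonempty := by
    by_contra hemp
    rw [Set.not_nonempty_iff_eq_empty] at hemp
    refine h0 (Subtype.ext (MvPowerSeries.ext fun ν => ?_))
    by_contra hν
    have : ν ∈ {ν | coeff ν a.1 ≠ 0} := hν
    rw [hemp] at this
    exact this
  obtain ⟨ν, hν, hmin⟩ := exists_minimalFor_of_wellFoundedLT (fun ν => coeff ν a.1 ≠ 0) size hne
  refine ⟨ν, ⟨⟨monomial 0 (coeff ν a.1)⁻¹, monomial_mem _ _⟩ * a, I.mul_mem_left _ ha, ?_, ?_⟩, hν⟩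
  · change coeff ν (C (coeff ν a.1)⁻¹ * a.1) = 1
    rw [coeff_C_mul, inv_mul_cancel₀ hν]
  · intro τ hτ
    change coeff τ (C (coeff ν a.1)⁻¹ * a.1) ≠ 0 at hτ
    rw [coeff_C_mul] at hτ
    rcases le_total (size ν) (size τ) with hle | hle
    · exact hle
    · exact hmin (right_ne_zero_of_mul hτ) hle

theorem part_mem {G : MvPowerSeries (Fin n) ℂ} (hG : G ∈ convergent n)
    (c : (Fin n →₀ ℕ) → (Fin n →₀ ℕ)) (ν : Fin n →₀ ℕ) : part c ν G ∈ convergent n := by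
  obtain ⟨s, hs⟩ := hG
  refine ⟨s, fun htop => hs (top_le_iff.1 ?_)⟩
  refine le_trans (le_of_eq ?_) (wt_mul_nrm_part_le s c ν G)
  rw [htop, ENNReal.mul_top (wt_ne_zero s ν)]

/-- By Dickson's lemma an ideal `I` has finitely many minimal leading exponents. Dividing `g ∈ I` by
elements with these leading exponents leaves a remainder in `I` none of whose exponents lies above
one of them; a nonzero remainder would have a leading exponent, so it vanishes. On a small enough
polydisc the leading terms dominate, and `nrm_solution_le` makes the quotients converge. -/
instance : IsNoetherianRing (convergent n) := by
  classical
  refine (isNoetherianRing_iff_ideal_fg _).2 fun I => ?_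
  have hfin : {ν | Minimal (· ∈ leading I) ν}.Finite :=
    (setOfPred_minimal_antichain _).finite_of_partiallyWellOrderedOn
      (Set.isPWO_of_wellQuasiOrderedLE _)
  set F := hfin.toFinset with hF
  have hFI : ∀ ν ∈ F, ν ∈ leading I := fun ν hν => by
    rw [hF, Set.Finite.mem_toFinset] at hν
    exact hν.1
  choose! a haI ha1 hamin using hFI
  set h : (Fin n →₀ ℕ) → MvPowerSeries (Fin n) ℂ := fun ν => (a ν).1 - monomial ν 1 with hh
  have hlt : ∀ ν ∈ F, ∀ τ, coeff τ (h ν) ≠ 0 → size ν < size τ := by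
    intro ν hν τ hτ
    have hne : τ ≠ ν := by
      rintro rfl
      simp [hh, ha1 τ hν] at hτ
    rw [hh, map_sub, coeff_monomial, if_neg hne, sub_zero] at hτ
    exact lt_of_le_of_ne (hamin ν hν τ hτ) fun he => hne (size_injective he).symm
  set red : (Fin n →₀ ℕ) → Prop := fun μ => ∃ ν ∈ F, ν ≤ μ with hred
  -- Each reducible exponent is assigned to one divisor in `F`, so that no term is removed twice.
  -- The default value 0 is harmless: if `0 ∈ F`, every exponent is reducible.
  set c : (Fin n →₀ ℕ) → (Fin n →₀ ℕ) := fun μ => if hμ : red μ then hμ.choose else 0 with hc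
  have hcF : ∀ μ, red μ → c μ ∈ F ∧ c μ ≤ μ := fun μ hμ => by
    rw [hc]
    simp only [dif_pos hμ]
    exact hμ.choose_spec
  refine ⟨F.image a, le_antisymm (Ideal.span_le.2 ?_) fun g hg => ?_⟩
  · intro x hx
    obtain ⟨ν, hν, rfl⟩ := Finset.mem_image.1 (Finset.mem_coe.1 hx)
    exact haI ν hν
  set G : MvPowerSeries (Fin n) ℂ := solution F c h g.1 with hG
  have hsol := solution_add_sum c g.1 hlt
  rw [← hG] at hsol
  have hGmem : G ∈ convergent n := by
    obtain ⟨s₀, hs₀⟩ := g.2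
    have hev : ∀ᶠ s in atTop, ∀ ν ∈ F, nrm s (h ν) ≤ (2 * #F : ℝ≥0∞)⁻¹ * wt s ν :=
      (Filter.eventually_all_finset F).2 fun ν hν =>
        eventually_nrm_le ((convergent n).sub_mem (a ν).2 (monomial_mem _ _)) (hlt ν hν)
          (ENNReal.inv_ne_zero.2 (ENNReal.mul_ne_top (by simp) (by simp)))
    obtain ⟨s, hs, hss⟩ := (hev.and (eventually_ge_atTop s₀)).exists
    exact ⟨s, ne_top_of_le_ne_top (ENNReal.mul_ne_top (by simp)
      (ne_top_of_le_ne_top hs₀ (nrm_antitone hss _))) (nrm_solution_le c g.1 hlt hs)⟩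
  set q : (Fin n →₀ ℕ) → convergent n := fun ν => ⟨part c ν G, part_mem hGmem c ν⟩ with hq
  set r : convergent n := g - ∑ ν ∈ F, q ν * a ν with hr
  have hrI : r ∈ I := I.sub_mem hg (I.sum_mem fun ν hν => I.mul_mem_left _ (haI ν hν))
  -- Since `a ν` is the monomial plus `h ν`, the remainder is `G` with all its assigned terms, the
  -- reducible ones, deleted.
  have hr_eq : r.1 = G - ∑ ν ∈ F, part c ν G * monomial ν 1 := by
    have : r.1 = g.1 - ∑ ν ∈ F, part c ν G * (a ν).1 := by
      change (convergent n).subtype r = _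
      rw [hr, map_sub, map_sum]
      rfl
    rw [this, ← hsol]
    simp only [hh, mul_sub, sum_sub_distrib]
    ring
  have hr0 : r = 0 := by
    by_contra hr0
    obtain ⟨μ, hμI, hμ⟩ := exists_le_of_mem hrI hr0
    obtain ⟨ν, hνμ, hνmin⟩ := exists_minimal_le_of_wellFoundedLT (· ∈ leading I) μ hμI
    have hμred : red μ := ⟨ν, by rw [hF, Set.Finite.mem_toFinset]; exact hνmin, hνμ⟩
    refine hμ ?_
    rw [hr_eq, map_sub, map_sum, sum_eq_single (c μ)]
    · rw [coeff_mul_monomial, if_pos (hcF μ hμred).2, coeff_part,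
        tsub_add_cancel_of_le (hcF μ hμred).2, if_pos rfl, mul_one, sub_self]
    · intro τ _ hτ
      rw [coeff_mul_monomial]
      split_ifs with hle
      · rw [coeff_part, tsub_add_cancel_of_le hle, if_neg hτ.symm, zero_mul]
      · rfl
    · exact fun hnot => absurd (hcF μ hμred).1 hnot
  have : g = ∑ ν ∈ F, q ν * a ν := sub_eq_zero.1 (hr ▸ hr0)
  rw [this]
  exact Submodule.sum_mem _ fun ν hν => Ideal.mul_mem_left _ _
    (Ideal.subset_span (Finset.mem_coe.2 (Finset.mem_image_of_mem a hν)))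

end ConvergentPowerSeries

/-! ### Germs of holomorphic functions as sums of convergent power series -/

namespace ConvergentPowerSeries

open Finset MvPowerSeries AnalyticGerm
open scoped ENNReal NNReal

variable {n : ℕ}

/-- The value at `y` of the monomial with exponent `ν`. -/
def monom (y : Fin n → ℂ) (ν : Fin n →₀ ℕ) : ℂ := ∏ i, y i ^ ν i

theorem monom_add (y : Fin n → ℂ) (ν μ : Fin n →₀ ℕ) :
    monom y (ν + μ) = monom y ν * monom y μ := by
  simp [monom, pow_add, prod_mul_distrib]

/-- The exponents of the monomials of degree `k`. -/
def ofDegree (n k : ℕ) : Finset (Fin n →₀ ℕ) := finsuppAntidiag univ k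

theorem mem_ofDegree {k : ℕ} {ν : Fin n →₀ ℕ} : ν ∈ ofDegree n k ↔ ν.degree = k := by
  simp [ofDegree, mem_finsuppAntidiag, Finsupp.degree_eq_sum]

theorem preimage_degree (k : ℕ) :
    (Finsupp.degree : (Fin n →₀ ℕ) → ℕ) ⁻¹' {k} = (ofDegree n k : Set (Fin n →₀ ℕ)) := by
  ext ν
  simp [mem_ofDegree]

theorem hasSum_degree {f : (Fin n →₀ ℕ) → ℂ} {a : ℂ} (hf : HasSum f a) :
    HasSum (fun k => ∑ ν ∈ ofDegree n k, f ν) a := by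
  have := hf.tsum_fiberwise (Finsupp.degree : (Fin n →₀ ℕ) → ℕ)
  refine (congrArg (HasSum · a) (funext fun k => ?_)).mpr this
  rw [← Finset.tsum_subtype', ← preimage_degree]

theorem tsum_degree (f : (Fin n →₀ ℕ) → ℝ≥0∞) :
    ∑' ν, f ν = ∑' k, ∑ ν ∈ ofDegree n k, f ν := by
  rw [← (Equiv.sigmaFiberEquiv (Finsupp.degree : (Fin n →₀ ℕ) → ℕ)).tsum_eq, ENNReal.tsum_sigma']
  refine tsum_congr fun k => ?_
  rw [← Finset.tsum_subtype', ← preimage_degree]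
  rfl

theorem wt_eq_prod (s : ℕ) (ν : Fin n →₀ ℕ) :
    wt s ν = ∏ i : Fin n, ((Nat.nth Nat.Prime i : ℝ≥0∞)⁻¹ ^ s) ^ ν i := by
  rw [wt, size, Nat.cast_prod, ENNReal.prod_inv_distrib, ← prod_pow]
  · refine prod_congr rfl fun i _ => ?_
    rw [Nat.cast_pow, ENNReal.inv_pow, ← pow_mul, ← pow_mul, mul_comm]
  · intro i _ j _ _
    exact Or.inr (ENNReal.natCast_ne_top _)

theorem wt_le (s : ℕ) (ν : Fin n →₀ ℕ) : wt s ν ≤ ((2 : ℝ≥0∞)⁻¹ ^ s) ^ ν.degree := by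
  rw [wt_eq_prod, Finsupp.degree_eq_sum, ← prod_pow_eq_pow_sum]
  refine prod_le_prod' fun i _ => ?_
  gcongr
  exact_mod_cast (Nat.prime_nth_prime i).two_le

/-- A common lower bound for the radii `pᵢ⁻ˢ`. -/
def rad (n s : ℕ) : ℝ≥0 := ((∏ i : Fin n, Nat.nth Nat.Prime i : ℕ) : ℝ≥0)⁻¹ ^ s

theorem rad_pos (n s : ℕ) : 0 < rad n s := by
  have : 0 < ∏ i : Fin n, Nat.nth Nat.Prime i :=
    prod_pos fun i _ => (Nat.prime_nth_prime i).pos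
  have : (0 : ℝ≥0) < (∏ i : Fin n, Nat.nth Nat.Prime i : ℕ) := by exact_mod_cast this
  exact pow_pos (inv_pos.2 this) _

theorem rad_le (s : ℕ) (i : Fin n) : (rad n s : ℝ≥0∞) ≤ (Nat.nth Nat.Prime i : ℝ≥0∞)⁻¹ ^ s := by
  have h0 : 0 < ∏ i : Fin n, Nat.nth Nat.Prime i :=
    prod_pos fun i _ => (Nat.prime_nth_prime i).pos
  rw [rad, ENNReal.coe_pow, ENNReal.coe_inv (by exact_mod_cast h0.ne')]
  gcongr
  rw [ENNReal.coe_natCast]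
  exact_mod_cast Nat.le_of_dvd h0 (dvd_prod_of_mem _ (mem_univ i))

theorem rad_pow_le (s : ℕ) (ν : Fin n →₀ ℕ) : (rad n s : ℝ≥0∞) ^ ν.degree ≤ wt s ν := by
  rw [wt_eq_prod, Finsupp.degree_eq_sum, ← prod_pow_eq_pow_sum]
  refine prod_le_prod' fun i _ => ?_
  gcongr
  exact rad_le s i

theorem enorm_monom_le {s : ℕ} {y : Fin n → ℂ} (hy : ‖y‖ₑ ≤ rad n s) (ν : Fin n →₀ ℕ) :
    ‖monom y ν‖ₑ ≤ wt s ν := by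
  rw [wt_eq_prod, monom, enorm_eq_nnnorm, nnnorm_prod, ENNReal.ofNNReal_finsetProd]
  refine prod_le_prod' fun i _ => ?_
  rw [← enorm_eq_nnnorm, enorm_pow]
  gcongr
  refine le_trans (le_trans ?_ hy) (rad_le s i)
  exact ENNReal.coe_le_coe.2 (nnnorm_le_pi_nnnorm y i)

theorem tsum_enorm_le {s : ℕ} {y : Fin n → ℂ} (hy : ‖y‖ₑ ≤ rad n s)
    (G : MvPowerSeries (Fin n) ℂ) : ∑' ν, ‖coeff ν G * monom y ν‖ₑ ≤ nrm s G :=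
  ENNReal.tsum_le_tsum fun ν => by
    rw [enorm_mul]
    gcongr
    exact enorm_monom_le hy ν

theorem summable_of_nrm {s : ℕ} {y : Fin n → ℂ} (hy : ‖y‖ₑ ≤ rad n s)
    {G : MvPowerSeries (Fin n) ℂ} (hG : nrm s G ≠ ∞) :
    Summable fun ν => ‖coeff ν G * monom y ν‖ := by
  have h1 := ne_top_of_le_ne_top hG (tsum_enorm_le hy G)
  have h2 : Summable fun ν => ‖coeff ν G * monom y ν‖₊ := ENNReal.tsum_coe_ne_top_iff_summable.1 h1
  exact NNReal.summable_coe.2 h2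

theorem eventually_enorm_le (n s : ℕ) : ∀ᶠ y : Fin n → ℂ in 𝓝 0, ‖y‖ₑ ≤ rad n s := by
  have : Tendsto (fun y : Fin n → ℂ => ‖y‖ₑ) (𝓝 0) (𝓝 0) := by
    simpa using (continuous_enorm (E := Fin n → ℂ)).tendsto 0
  exact this.eventually_le_const (by exact_mod_cast rad_pos n s)

/-- The sum of a power series. -/
def sum (G : MvPowerSeries (Fin n) ℂ) (y : Fin n → ℂ) : ℂ := ∑' ν, coeff ν G * monom y ν

theorem eventually_summable {G : MvPowerSeries (Fin n) ℂ} (hG : G ∈ convergent n) :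
    ∀ᶠ y in 𝓝 0, Summable fun ν => ‖coeff ν G * monom y ν‖ := by
  obtain ⟨s, hs⟩ := hG
  filter_upwards [eventually_enorm_le n s] with y hy using summable_of_nrm hy hs

theorem sum_add {G H : MvPowerSeries (Fin n) ℂ} {y : Fin n → ℂ}
    (hG : Summable fun ν => ‖coeff ν G * monom y ν‖)
    (hH : Summable fun ν => ‖coeff ν H * monom y ν‖) : sum (G + H) y = sum G y + sum H y := by
  rw [sum, sum, sum, ← hG.of_norm.tsum_add hH.of_norm]
  simp only [map_add, add_mul]

theorem sum_mul {G H : MvPowerSeries (Fin n) ℂ} {y : Fin n → ℂ}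
    (hG : Summable fun ν => ‖coeff ν G * monom y ν‖)
    (hH : Summable fun ν => ‖coeff ν H * monom y ν‖) : sum (G * H) y = sum G y * sum H y := by
  have hGH := summable_mul_of_summable_norm hG hH
  rw [sum, sum, sum, Summable.tsum_mul_tsum_eq_tsum_sum_antidiagonal hG.of_norm hH.of_norm hGH]
  refine tsum_congr fun ν => ?_
  rw [coeff_mul, Finset.sum_mul]
  refine sum_congr rfl fun p hp => ?_
  rw [← mem_antidiagonal.1 hp, monom_add]
  ring

theorem sum_monomial (ν : Fin n →₀ ℕ) (c : ℂ) (y : Fin n → ℂ) :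
    sum (monomial ν c) y = c * monom y ν := by
  classical
  rw [sum, tsum_eq_single ν]
  · simp
  · intro μ hμ
    simp [coeff_monomial, hμ]

/-- The exponent of the product of the variables in a word. -/
def exponent {k : ℕ} (w : Fin k → Fin n) : Fin n →₀ ℕ := ∑ j, Finsupp.single (w j) 1

theorem degree_exponent {k : ℕ} (w : Fin k → Fin n) : (exponent w).degree = k := by
  simp [exponent, map_sum]

theorem monom_exponent {k : ℕ} (w : Fin k → Fin n) (y : Fin n → ℂ) :
    monom y (exponent w) = ∏ j, y (w j) := by
  simp only [monom, exponent, Finsupp.finsetSum_apply, ← prod_pow_eq_pow_sum]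
  rw [Finset.prod_comm]
  refine prod_congr rfl fun j _ => ?_
  rw [prod_eq_single (w j)]
  · simp
  · intro i _ hi
    simp [hi.symm]
  · simp

theorem exists_exponent_eq (ν : Fin n →₀ ℕ) : ∃ w : Fin ν.degree → Fin n, exponent w = ν := by
  induction ν using Finsupp.induction_linear with
  | zero => exact ⟨fun j => absurd j.2 (by simp), Finset.sum_eq_zero fun j _ => absurd j.2 (by simp)⟩
  | add ν μ hν hμ =>
    obtain ⟨v, hv⟩ := hν
    obtain ⟨w, hw⟩ := hμ
    rw [map_add]
    refine ⟨Fin.append v w, ?_⟩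
    rw [exponent, Fin.sum_univ_add]
    simp only [Fin.append_left, Fin.append_right]
    rw [← exponent, ← exponent, hv, hw]
  | single i a =>
    refine ⟨fun _ => i, ?_⟩
    simp [exponent]

open Classical in
/-- The monomial with exponent `ν` as a multilinear map. -/
def multilinearMonom (k : ℕ) (ν : Fin n →₀ ℕ) :
    ContinuousMultilinearMap ℂ (fun _ : Fin k => Fin n → ℂ) ℂ :=
  if h : ∃ w : Fin k → Fin n, exponent w = ν then
    (ContinuousMultilinearMap.mkPiAlgebra ℂ (Fin k) ℂ).compContinuousLinearMap
      fun j => ContinuousLinearMap.proj (h.choose j)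
  else 0

theorem multilinearMonom_apply {k : ℕ} {ν : Fin n →₀ ℕ} (hν : ν ∈ ofDegree n k)
    (y : Fin n → ℂ) : multilinearMonom k ν (fun _ => y) = monom y ν := by
  obtain rfl := mem_ofDegree.1 hν
  have h := exists_exponent_eq ν
  rw [multilinearMonom, dif_pos h, ContinuousMultilinearMap.compContinuousLinearMap_apply,
    ContinuousMultilinearMap.mkPiAlgebra_apply]
  conv_rhs => rw [← h.choose_spec, monom_exponent]
  rfl

theorem enorm_multilinearMonom_le (k : ℕ) (ν : Fin n →₀ ℕ) : ‖multilinearMonom k ν‖ₑ ≤ 1 := by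
  have : ‖multilinearMonom k ν‖ ≤ 1 := by
    rw [multilinearMonom]
    split_ifs with h
    · refine ContinuousMultilinearMap.opNorm_le_bound zero_le_one fun v => ?_
      rw [ContinuousMultilinearMap.compContinuousLinearMap_apply,
        ContinuousMultilinearMap.mkPiAlgebra_apply, norm_prod, one_mul]
      exact prod_le_prod (fun _ _ => norm_nonneg _) fun j _ => norm_le_pi_norm (v j) _
    · simp
  rw [← ofReal_norm]
  exact ENNReal.ofReal_le_one.2 this

/-- The homogeneous parts of a power series. -/
def toFormal (G : MvPowerSeries (Fin n) ℂ) : FormalMultilinearSeries ℂ (Fin n → ℂ) ℂ :=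
  fun k => ∑ ν ∈ ofDegree n k, coeff ν G • multilinearMonom k ν

theorem toFormal_apply (G : MvPowerSeries (Fin n) ℂ) (k : ℕ) (y : Fin n → ℂ) :
    (toFormal G k fun _ => y) = ∑ ν ∈ ofDegree n k, coeff ν G * monom y ν := by
  rw [toFormal, _root_.sum_apply]
  refine sum_congr rfl fun ν hν => ?_
  rw [_root_.smul_apply, multilinearMonom_apply hν, smul_eq_mul]

theorem hasSum_toFormal {s : ℕ} {y : Fin n → ℂ} (hy : ‖y‖ₑ ≤ rad n s)
    {G : MvPowerSeries (Fin n) ℂ} (hG : nrm s G ≠ ∞) :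
    HasSum (fun k => toFormal G k fun _ => y) (sum G y) := by
  simp only [toFormal_apply]
  exact hasSum_degree (summable_of_nrm hy hG).of_norm.hasSum

/-- Terms are grouped by degree. As `rad n s` bounds all radii of the polydisc from below, the
`k`-th homogeneous part has norm at most `nrm s G / rad n s ^ k`. -/
theorem analyticAt_sum {G : MvPowerSeries (Fin n) ℂ} (hG : G ∈ convergent n) :
    AnalyticAt ℂ (sum G) 0 := by
  obtain ⟨s, hs⟩ := hG
  refine ⟨toFormal G, rad n s, ?_, by exact_mod_cast rad_pos n s, fun {y} hy => ?_⟩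
  · lift nrm s G to ℝ≥0 using hs with C hC
    refine FormalMultilinearSeries.le_radius_of_bound_nnreal _ C fun k => ?_
    rw [← ENNReal.coe_le_coe, hC, ENNReal.coe_mul, ENNReal.coe_pow]
    change ‖toFormal G k‖ₑ * _ ≤ _
    calc ‖toFormal G k‖ₑ * (rad n s : ℝ≥0∞) ^ k
        ≤ (∑ ν ∈ ofDegree n k, ‖coeff ν G‖ₑ) * (rad n s : ℝ≥0∞) ^ k := by
          gcongr
          rw [toFormal]
          refine (enorm_sum_le (ofDegree n k)
            fun ν => coeff ν G • multilinearMonom k ν).trans (sum_le_sum fun ν _ => ?_)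
          rw [enorm_smul]
          exact mul_le_of_le_one_right zero_le (enorm_multilinearMonom_le _ _)
      _ ≤ ∑ ν ∈ ofDegree n k, ‖coeff ν G‖ₑ * wt s ν := by
          rw [Finset.sum_mul]
          refine sum_le_sum fun ν hν => ?_
          gcongr
          rw [← mem_ofDegree.1 hν]
          exact rad_pow_le s ν
      _ ≤ nrm s G := ENNReal.sum_le_tsum _
  · rw [zero_add]
    refine hasSum_toFormal (le_of_lt ?_) hs
    rwa [Metric.mem_eball, edist_zero_right] at hy

variable {p : Fin n → ℂ}

theorem analyticAt_sum_sub {G : MvPowerSeries (Fin n) ℂ} (hG : G ∈ convergent n) :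
    AnalyticAt ℂ (fun z => sum G (z - p)) p :=
  AnalyticAt.fun_comp (by rw [sub_self]; exact analyticAt_sum hG) (analyticAt_id.sub analyticAt_const)

theorem tendsto_sub_self : Tendsto (fun z => z - p) (𝓝 p) (𝓝 0) := by
  simpa using (continuous_sub_right p).tendsto p

/-- The germ at `p` of the sum of a convergent power series in `z - p`. -/
def toHolGerm (p : Fin n → ℂ) : convergent n →+* holGerm p where
  toFun G := holGerm.mk (fun z => sum G.1 (z - p)) (analyticAt_sum_sub G.2)
  map_one' := Subtype.ext (Germ.coe_eq.2 (.of_forall fun z => by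
    change sum (monomial 0 1) (z - p) = 1
    rw [sum_monomial]
    simp [monom]))
  map_zero' := Subtype.ext (Germ.coe_eq.2 (.of_forall fun z => by
    change sum 0 (z - p) = 0
    simp [sum]))
  map_mul' G H := Subtype.ext (Germ.coe_eq.2 (by
    filter_upwards [tendsto_sub_self.eventually (eventually_summable G.2),
      tendsto_sub_self.eventually (eventually_summable H.2)] with z h1 h2 using sum_mul h1 h2))
  map_add' G H := Subtype.ext (Germ.coe_eq.2 (by
    filter_upwards [tendsto_sub_self.eventually (eventually_summable G.2),
      tendsto_sub_self.eventually (eventually_summable H.2)] with z h1 h2 using sum_add h1 h2))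

open Classical in
/-- The power series with given homogeneous parts. -/
def ofFormal (q : FormalMultilinearSeries ℂ (Fin n → ℂ) ℂ) : MvPowerSeries (Fin n) ℂ :=
  fun ν => ∑ w : Fin ν.degree → Fin n with exponent w = ν,
    q ν.degree fun j => Pi.single (w j) 1

open Classical in
theorem coeff_ofFormal (q : FormalMultilinearSeries ℂ (Fin n → ℂ) ℂ) {k : ℕ} {ν : Fin n →₀ ℕ}
    (hν : ν ∈ ofDegree n k) : coeff ν (ofFormal q) =
      ∑ w : Fin k → Fin n with exponent w = ν, q k fun j => Pi.single (w j) 1 := by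
  obtain rfl := mem_ofDegree.1 hν
  rfl

/-- The maps `q k` need not be symmetric, so only diagonal values are recovered: expand `y` in the
standard basis and collect the words with the same exponent. -/
theorem toFormal_ofFormal_apply (q : FormalMultilinearSeries ℂ (Fin n → ℂ) ℂ) (k : ℕ)
    (y : Fin n → ℂ) : (toFormal (ofFormal q) k fun _ => y) = q k fun _ => y := by
  classical
  rw [toFormal_apply]
  have hy : y = ∑ i, y i • (Pi.single i 1 : Fin n → ℂ) := by
    ext j
    simp [Pi.single_apply]
  have h1 : (q k fun _ => y) = ∑ w : Fin k → Fin n,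
      monom y (exponent w) * q k fun j => Pi.single (w j) 1 := by
    conv_lhs => rw [hy]
    rw [(q k).map_sum]
    refine sum_congr rfl fun w _ => ?_
    rw [(q k).map_smul_univ, monom_exponent, smul_eq_mul]
  rw [h1, ← sum_fiberwise_of_maps_to (t := ofDegree n k) (g := exponent)
    fun w _ => mem_ofDegree.2 (degree_exponent w)]
  refine sum_congr rfl fun ν hν => ?_
  rw [coeff_ofFormal q hν, Finset.sum_mul]
  refine sum_congr rfl fun w hw => ?_
  rw [(mem_filter.1 hw).2, mul_comm]

theorem sum_enorm_coeff_ofFormal_le (q : FormalMultilinearSeries ℂ (Fin n → ℂ) ℂ) (k : ℕ) :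
    ∑ ν ∈ ofDegree n k, ‖coeff ν (ofFormal q)‖ₑ ≤ n ^ k * ‖q k‖ₑ := by
  classical
  calc ∑ ν ∈ ofDegree n k, ‖coeff ν (ofFormal q)‖ₑ
      ≤ ∑ ν ∈ ofDegree n k, ∑ w : Fin k → Fin n with exponent w = ν, ‖q k‖ₑ := by
        refine sum_le_sum fun ν hν => ?_
        rw [coeff_ofFormal q hν]
        refine (enorm_sum_le _ _).trans (sum_le_sum fun w _ => ?_)
        have := (q k).le_opNorm fun j => Pi.single (w j) 1
        rw [← ofReal_norm, ← ofReal_norm]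
        refine ENNReal.ofReal_le_ofReal (this.trans (mul_le_of_le_one_right (norm_nonneg _) ?_))
        refine prod_le_one (fun _ _ => norm_nonneg _) fun j _ => ?_
        refine (pi_norm_le_iff_of_nonneg zero_le_one).2 fun i => ?_
        rw [Pi.single_apply]
        split_ifs <;> simp
    _ = n ^ k * ‖q k‖ₑ := by
        rw [sum_fiberwise_of_maps_to fun w _ => mem_ofDegree.2 (degree_exponent w)]
        simp

/-- There are `n ^ k` words of length `k`. This loss is absorbed by taking `s` with `n * 2⁻¹ ^ s ≤ t
/ 2` for some `t` below the radius of convergence; what remains is dominated by a geometric series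
of ratio one half. -/
theorem ofFormal_mem {q : FormalMultilinearSeries ℂ (Fin n → ℂ) ℂ} (hq : 0 < q.radius) :
    ofFormal q ∈ convergent n := by
  obtain ⟨t, ht0, htq⟩ := ENNReal.lt_iff_exists_nnreal_btwn.1 hq
  have ht0 : 0 < t := by exact_mod_cast ht0
  obtain ⟨C, _, hC⟩ := q.nnnorm_mul_pow_le_of_lt_radius htq
  have hlim : Tendsto (fun s : ℕ => (n : ℝ≥0∞) * (2 : ℝ≥0∞)⁻¹ ^ s) atTop (𝓝 0) := by
    have := ENNReal.Tendsto.const_mul (a := (n : ℝ≥0∞))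
      (ENNReal.tendsto_pow_atTop_nhds_zero_of_lt_one (r := 2⁻¹) (by simp))
      (Or.inr (ENNReal.natCast_ne_top _))
    simpa using this
  obtain ⟨s, hs⟩ := (hlim.eventually_le_const (u := (t : ℝ≥0∞) * 2⁻¹)
    (ENNReal.mul_pos (by exact_mod_cast ht0.ne') (by simp))).exists
  refine ⟨s, ne_top_of_le_ne_top (b := ∑' k : ℕ, (C : ℝ≥0∞) * 2⁻¹ ^ k) ?_ ?_⟩
  · rw [ENNReal.tsum_mul_left]
    refine ENNReal.mul_ne_top ENNReal.coe_ne_top ?_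
    rw [ENNReal.tsum_geometric, ENNReal.one_sub_inv_two]
    simp
  · rw [nrm, tsum_degree]
    refine ENNReal.tsum_le_tsum fun k => ?_
    calc ∑ ν ∈ ofDegree n k, ‖coeff ν (ofFormal q)‖ₑ * wt s ν
        ≤ ∑ ν ∈ ofDegree n k, ‖coeff ν (ofFormal q)‖ₑ * (2⁻¹ ^ s) ^ k := by
          refine sum_le_sum fun ν hν => ?_
          gcongr
          rw [← mem_ofDegree.1 hν]
          exact wt_le s ν
      _ ≤ (n ^ k * ‖q k‖ₑ) * (2⁻¹ ^ s) ^ k := by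
          rw [← Finset.sum_mul]
          gcongr
          exact sum_enorm_coeff_ofFormal_le q k
      _ = ‖q k‖ₑ * (n * 2⁻¹ ^ s) ^ k := by ring
      _ ≤ ‖q k‖ₑ * (t * 2⁻¹) ^ k := by gcongr
      _ = (‖q k‖ₑ * t ^ k) * 2⁻¹ ^ k := by ring
      _ ≤ C * 2⁻¹ ^ k := by
          gcongr
          have := ENNReal.coe_le_coe.2 (hC k)
          rwa [ENNReal.coe_mul, ENNReal.coe_pow] at this

/-- This is Taylor expansion. Injectivity is not needed, because a quotient of a Noetherian ring is
Noetherian. -/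
theorem toHolGerm_surjective (p : Fin n → ℂ) : Function.Surjective (toHolGerm p) := by
  rintro ⟨_, f, ⟨q, r, hq⟩, rfl⟩
  have hmem := ofFormal_mem (hq.r_pos.trans_le hq.r_le)
  refine ⟨⟨ofFormal q, hmem⟩, Subtype.ext (Germ.coe_eq.2 ?_)⟩
  obtain ⟨s, hs⟩ := hmem
  have h1 : ∀ᶠ y : Fin n → ℂ in 𝓝 0, y ∈ Metric.eball (0 : Fin n → ℂ) r :=
    Metric.eball_mem_nhds _ hq.r_pos
  filter_upwards [tendsto_sub_self.eventually (eventually_enorm_le n s),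
    tendsto_sub_self.eventually h1] with z hz1 hz2
  have h2 := hasSum_toFormal hz1 hs
  simp only [toFormal_ofFormal_apply] at h2
  have h3 := hq.hasSum hz2
  rw [add_sub_cancel] at h3
  exact h2.unique h3

end ConvergentPowerSeries

/-! ### Noetherianity of the local rings -/

namespace AnalyticGerm

instance {n : ℕ} (p : Fin n → ℂ) : IsNoetherianRing (holGerm p) :=
  isNoetherianRing_of_surjective _ _ (ConvergentPowerSeries.toHolGerm p)
    (ConvergentPowerSeries.toHolGerm_surjective p)

theorem toStalk_surjective (X : AnalyticGerm) : Function.Surjective X.toStalk :=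
  Ideal.Quotient.mk_surjective

instance (X : AnalyticGerm) : IsNoetherianRing X.stalk :=
  isNoetherianRing_of_surjective _ _ X.toStalk.toRingHom X.toStalk_surjective

end AnalyticGerm

namespace AnalyticGerm

open IsLocalRing

/-! ### Elements of the local ring and morphisms to the line -/

/-- The value at `p` of a holomorphic germ. -/
def holGerm.value {n : ℕ} (p : Fin n → ℂ) : holGerm p →+* ℂ :=
  (Germ.valueRingHom (X := Fin n → ℂ) (E := ℂ) (x := p)).comp (holGerm p).val.toRingHom

theorem holGerm.value_algebraMap {n : ℕ} (p : Fin n → ℂ) (c : ℂ) :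
    holGerm.value p (algebraMap ℂ _ c) = c := by
  have : algebraMap ℂ (holGerm p) c = holGerm.mk (fun _ => c) analyticAt_const := by
    refine Subtype.ext ?_
    change algebraMap ℂ (Germ (𝓝 p) ℂ) c = _
    rw [Algebra.algebraMap_eq_smul_one]
    refine congrArg _ (funext fun _ => ?_)
    simp
  rw [this]
  rfl

theorem holGerm.ker_value {n : ℕ} (p : Fin n → ℂ) :
    RingHom.ker (holGerm.value p) = maximalIdeal (holGerm p) := by
  refine IsLocalRing.eq_maximalIdeal (RingHom.ker_isMaximal_of_surjective _ fun c => ?_)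
  exact ⟨algebraMap ℂ _ c, holGerm.value_algebraMap p c⟩

theorem holGerm.exists_of_mem {n : ℕ} {p : Fin n → ℂ} {F : holGerm p}
    (hF : F ∈ maximalIdeal (holGerm p)) :
    ∃ (f : (Fin n → ℂ) → ℂ) (hf : AnalyticAt ℂ f p), f p = 0 ∧ F = holGerm.mk f hf := by
  rw [← holGerm.ker_value] at hF
  obtain ⟨_, f, hf, rfl⟩ := F
  exact ⟨f, hf, hF, rfl⟩

/-- The constant is the value at the base point; the residue field is therefore `ℂ`. -/
theorem exists_sub_algebraMap_mem (X : AnalyticGerm) (a : X.stalk) :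
    ∃ c : ℂ, a - algebraMap ℂ X.stalk c ∈ maximalIdeal X.stalk := by
  obtain ⟨F, rfl⟩ := X.toStalk_surjective a
  refine ⟨holGerm.value X.pt F, ?_⟩
  rw [← X.toStalk.commutes, ← map_sub]
  have hloc : IsLocalHom X.toStalk.toRingHom := .of_surjective _ X.toStalk_surjective
  refine map_nonunit X.toStalk.toRingHom _ ?_
  rw [← holGerm.ker_value, RingHom.mem_ker, map_sub, holGerm.value_algebraMap, sub_self]

/-- The germ of the complex line at the origin. -/
def line : AnalyticGerm where
  ambDim := 1
  pt := 0
  ideal := ⊥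
  ideal_ne_top := bot_ne_top

theorem analyticAt_coord : AnalyticAt ℂ (fun z : Fin 1 → ℂ => z 0) 0 :=
  (ContinuousLinearMap.proj (R := ℂ) (φ := fun _ : Fin 1 => ℂ) 0).analyticAt 0

/-- The coordinate of the line. -/
def coord : line.stalk := line.toStalk (holGerm.mk (fun z : Fin 1 → ℂ => z 0) analyticAt_coord)

/-- The quotient `(f(t) - f(0)) / t` extends holomorphically over 0; the extension is `dslope`. -/
theorem line_exists_eq (a : line.stalk) :
    ∃ (c : ℂ) (b : line.stalk), a = algebraMap ℂ _ c + coord * b := by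
  obtain ⟨⟨_, f, hf, rfl⟩, rfl⟩ := line.toStalk_surjective a
  have hf : AnalyticAt ℂ f (0 : Fin 1 → ℂ) := hf
  have hdiag : AnalyticAt ℂ (fun t : ℂ => (fun _ : Fin 1 => t)) 0 :=
    (ContinuousLinearMap.pi fun _ : Fin 1 => ContinuousLinearMap.id ℂ ℂ).analyticAt 0
  have h0 : AnalyticAt ℂ (fun t : ℂ => f fun _ => t) 0 := AnalyticAt.fun_comp hf hdiag
  obtain ⟨q, hq⟩ := h0
  have hd : AnalyticAt ℂ (fun z : Fin 1 → ℂ => dslope (fun t : ℂ => f fun _ => t) 0 (z 0)) 0 :=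
    AnalyticAt.fun_comp (g := dslope (fun t : ℂ => f fun _ => t) 0)
      hq.has_fpower_series_dslope_fslope.analyticAt analyticAt_coord
  refine ⟨f 0, line.toStalk (holGerm.mk _ hd), ?_⟩
  rw [coord, ← line.toStalk.commutes, ← map_mul, ← map_add]
  refine congrArg _ (Subtype.ext ?_)
  have hc : algebraMap ℂ (holGerm (0 : Fin 1 → ℂ)) (f 0) =
      holGerm.mk (fun _ => f 0) analyticAt_const := by
    refine Subtype.ext ?_
    change algebraMap ℂ (Germ (𝓝 (0 : Fin 1 → ℂ)) ℂ) (f 0) = _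
    rw [Algebra.algebraMap_eq_smul_one]
    refine congrArg _ (funext fun _ => ?_)
    simp
  change _ = (algebraMap ℂ (holGerm (0 : Fin 1 → ℂ)) (f 0)).1 + _
  rw [hc]
  refine Germ.coe_eq.2 (.of_forall fun (z : Fin 1 → ℂ) => ?_)
  have hz : f z = f fun _ => z 0 :=
    congrArg f (funext fun i => congrArg z (Subsingleton.elim i 0))
  have := sub_smul_dslope (fun t : ℂ => f fun _ => t) 0 (z 0)
  simp only [sub_zero, smul_eq_mul] at this
  change f z = f 0 + z 0 * dslope (fun t : ℂ => f fun _ => t) 0 (z 0)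
  rw [this]
  refine hz.trans ?_
  change _ = f 0 + (_ - f 0)
  ring

/-- Writing `a = c + coord * b` repeatedly shows that `u a - v a` lies in every power of the maximal
ideal; Krull's intersection theorem concludes. -/
theorem hom_line_ext {W : AnalyticGerm} {u v : line.stalk →ₐ[ℂ] W.stalk}
    (hu : u coord ∈ maximalIdeal W.stalk) (h : u coord = v coord) : u = v := by
  have key : ∀ (k : ℕ) (a : line.stalk), u a - v a ∈ maximalIdeal W.stalk ^ k := by
    intro k
    induction k with
    | zero => simp
    | succ k ih =>
      intro a
      obtain ⟨c, b, rfl⟩ := line_exists_eq a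
      have : u (algebraMap ℂ _ c + coord * b) - v (algebraMap ℂ _ c + coord * b) =
          u coord * (u b - v b) := by
        simp only [map_add, map_mul, AlgHom.commutes, ← h]
        ring
      rw [this, pow_succ']
      exact Ideal.mul_mem_mul hu (ih b)
  ext a
  rw [← sub_eq_zero, ← Ideal.mem_bot,
    ← Ideal.iInf_pow_eq_bot_of_isLocalRing _ (maximalIdeal.isMaximal W.stalk).ne_top]
  exact Ideal.mem_iInf.2 fun k => key k a

/-- A representative of `a` is itself a holomorphic map to `ℂ` vanishing at the base point. Together
with `hom_line_ext`, the line represents the functor `W ↦ 𝔪_W`. -/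
theorem exists_hom_line {W : AnalyticGerm} {a : W.stalk} (ha : a ∈ maximalIdeal W.stalk) :
    ∃ u : W ⟶ line, comap u coord = a := by
  have hloc : IsLocalHom W.toStalk.toRingHom := .of_surjective _ W.toStalk_surjective
  obtain ⟨F, rfl⟩ := W.toStalk_surjective a
  have hF : F ∈ maximalIdeal (holGerm W.pt) := by
    rw [← maximalIdeal_comap W.toStalk.toRingHom]
    exact ha
  obtain ⟨f, hf, hf0, rfl⟩ := holGerm.exists_of_mem hF
  have hφ : AnalyticAt ℂ (fun z (_ : Fin 1) => f z) W.pt := analyticAt_pi_iff.2 fun _ => hf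
  have hz : (fun (_ : Fin 1) => f W.pt) = (0 : Fin 1 → ℂ) := funext fun _ => hf0
  refine ⟨⟨Ideal.Quotient.liftₐ _ (W.toStalk.comp (holGerm.pullback _ hφ hz)) fun b hb => ?_,
    _, hφ, hz, fun F => rfl⟩, rfl⟩
  have hb' : b ∈ (⊥ : Ideal (holGerm line.pt)) := hb
  rw [Ideal.mem_bot.1 hb', map_zero]

/-! ### The local ring of a gluing -/

section Gluing

variable {X Y Z V : AnalyticGerm} {α : Z ⟶ X} {β : Z ⟶ Y} {f : X ⟶ V} {g : Y ⟶ V}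

theorem comap_comp {W : AnalyticGerm} (u : Z ⟶ X) (v : X ⟶ W) :
    comap (u ≫ v) = (comap u).comp (comap v) := rfl

theorem hom_line_hom_ext {W : AnalyticGerm} {u v : W ⟶ line}
    (hu : comap u coord ∈ maximalIdeal W.stalk) (h : comap u coord = comap v coord) : u = v :=
  Hom.ext (hom_line_ext hu h)

theorem mem_maximalIdeal_of_map {R S : Type*} [CommRing R] [CommRing S] [IsLocalRing R]
    [IsLocalRing S] (φ : R →+* S) {a : R} (ha : φ a ∈ maximalIdeal S) : a ∈ maximalIdeal R :=
  fun hu => ha (hu.map φ)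

theorem comap_comap_of_isPushout (hV : IsPushout α β f g) (a : V.stalk) :
    comap α (comap f a) = comap β (comap g a) :=
  DFunLike.congr_fun (congrArg comap hV.w) a

/-- After subtraction of a common constant, `r` and `s` lie in the maximal ideals and are morphisms
to the line that agree on `Z`. The pushout glues them. -/
theorem exists_of_isPushout (hα : Function.Surjective (comap α)) (hV : IsPushout α β f g)
    {r : X.stalk} {s : Y.stalk} (h : comap α r = comap β s) :
    ∃ a : V.stalk, comap f a = r ∧ comap g a = s := by
  have hloc : IsLocalHom (comap α).toRingHom := .of_surjective _ hα
  obtain ⟨c, hc⟩ := X.exists_sub_algebraMap_mem r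
  have hcZ : comap α (r - algebraMap ℂ _ c) ∈ maximalIdeal Z.stalk :=
    map_nonunit (comap α).toRingHom _ hc
  have h' : comap α (r - algebraMap ℂ _ c) = comap β (s - algebraMap ℂ _ c) := by
    simp only [map_sub, AlgHom.commutes, h]
  have hcY : s - algebraMap ℂ _ c ∈ maximalIdeal Y.stalk :=
    mem_maximalIdeal_of_map (comap β).toRingHom (h' ▸ hcZ :)
  obtain ⟨u, hu⟩ := exists_hom_line hc
  obtain ⟨v, hv⟩ := exists_hom_line hcY
  have huv : α ≫ u = β ≫ v := by
    refine hom_line_hom_ext ?_ ?_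
    · rw [comap_comp, AlgHom.comp_apply, hu]
      exact hcZ
    · rw [comap_comp, comap_comp, AlgHom.comp_apply, AlgHom.comp_apply, hu, hv, h']
  obtain ⟨w, hw1, hw2⟩ := hV.exists_desc u v huv
  refine ⟨comap w coord + algebraMap ℂ _ c, ?_, ?_⟩
  · rw [map_add, AlgHom.commutes, ← AlgHom.comp_apply, ← comap_comp, hw1, hu, sub_add_cancel]
  · rw [map_add, AlgHom.commutes, ← AlgHom.comp_apply, ← comap_comp, hw2, hv, sub_add_cancel]

/-- The elements `a` and 0 correspond to morphisms `V ⟶ line` that agree after composition with `f`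
and `g`, so uniqueness in the pushout applies. -/
theorem eq_zero_of_isPushout (hV : IsPushout α β f g) {a : V.stalk}
    (hf : comap f a = 0) (hg : comap g a = 0) : a = 0 := by
  have ha : a ∈ maximalIdeal V.stalk :=
    mem_maximalIdeal_of_map (comap f).toRingHom
      (show comap f a ∈ maximalIdeal X.stalk by rw [hf]; exact zero_mem _)
  obtain ⟨w, rfl⟩ := exists_hom_line ha
  obtain ⟨w₀, hw₀⟩ := exists_hom_line (zero_mem (maximalIdeal V.stalk))
  have : w = w₀ := by
    refine hV.hom_ext (hom_line_hom_ext ?_ ?_) (hom_line_hom_ext ?_ ?_) <;>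
      simp only [comap_comp, AlgHom.comp_apply, hf, hg, hw₀, map_zero, zero_mem]
  rw [this, hw₀]

theorem comap_left_surjective (hα : Function.Surjective (comap α))
    (hβ : Function.Surjective (comap β)) (hV : IsPushout α β f g) :
    Function.Surjective (comap f) := fun r => by
  obtain ⟨s, hs⟩ := hβ (comap α r)
  obtain ⟨a, ha, _⟩ := exists_of_isPushout hα hV hs.symm
  exact ⟨a, ha⟩

theorem comap_right_surjective (hα : Function.Surjective (comap α)) (hV : IsPushout α β f g) :
    Function.Surjective (comap g) := fun s => by
  obtain ⟨r, hr⟩ := hα (comap β s)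
  obtain ⟨a, _, ha⟩ := exists_of_isPushout hα hV hr
  exact ⟨a, ha⟩

end Gluing

end AnalyticGerm

/-! ### The long exact sequence of `Tor` in the first variable -/

namespace TorSequence

open MonoidalCategory

variable {B : Type} [CommRing B]

/-- The functor `M ↦ M ⊗ P` to complexes, for a complex `P`. -/
def tensorComplex (P : ChainComplex (ModuleCat.{0} B) ℕ) :
    ModuleCat.{0} B ⥤ ChainComplex (ModuleCat.{0} B) ℕ where
  obj M := (((tensoringLeft _).obj M).mapHomologicalComplex _).obj P
  map u := (NatTrans.mapHomologicalComplex ((tensoringLeft _).map u) _).app P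
  map_id M := by ext : 1; simp
  map_comp u v := by ext : 1; simp

variable (P : ChainComplex (ModuleCat.{0} B) ℕ)

instance : (tensorComplex P).PreservesZeroMorphisms where
  map_zero M N := by
    ext : 1
    change (0 : M ⟶ N) ▷ _ = 0
    simp

/-- Projective modules are flat. `Tor` is derived in its second variable, so sequences in the first
variable are obtained by tensoring with a resolution of the second argument. -/
theorem shortExact_tensorComplex (hP : ∀ n, Projective (P.X n)) {S : ShortComplex (ModuleCat.{0} B)}
    (hS : S.ShortExact) : (S.map (tensorComplex P)).ShortExact := by
  refine HomologicalComplex.shortExact_of_degreewise_shortExact _ fun n => ?_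
  have : Module.Projective B (P.X n) := (IsProjective.iff_projective (P.X n)).2 (hP n)
  exact hS.map_of_exact (tensorRight (P.X n))

variable {K : ModuleCat.{0} B} (Q : ProjectiveResolution K)

/-- `Tor` as the homology of the tensor product with a resolution. -/
def torIso (M : ModuleCat.{0} B) (i : ℕ) :
    ((Tor (ModuleCat.{0} B) i).obj M).obj K ≅ ((tensorComplex Q.complex).obj M).homology i :=
  Q.isoLeftDerivedObj ((tensoringLeft _).obj M) i

theorem isZero_homology (M : ModuleCat.{0} B) [Module.Flat B M] (i : ℕ) :
    Limits.IsZero (((tensorComplex Q.complex).obj M).homology (i + 1)) := by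
  rw [← HomologicalComplex.exactAt_iff_isZero_homology]
  exact (Q.complex_exactAt_succ i).map (tensorLeft M)

theorem shortExact (S : ShortComplex (ModuleCat.{0} B)) (hS : S.ShortExact) :
    (S.map (tensorComplex Q.complex)).ShortExact :=
  shortExact_tensorComplex _ Q.projective hS

/-- Dimension shifting: the connecting map is an isomorphism because the higher `Tor` of the flat
middle term vanish. -/
theorem nonempty_tor_equiv (K : ModuleCat.{0} B) {S : ShortComplex (ModuleCat.{0} B)}
    (hS : S.ShortExact) [Module.Flat B S.X₂] (i : ℕ) :
    Nonempty (((Tor (ModuleCat.{0} B) (i + 2)).obj S.X₃).obj K ≃ₗ[B]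
      ((Tor (ModuleCat.{0} B) (i + 1)).obj S.X₁).obj K) := by
  obtain ⟨Q⟩ := (inferInstance : HasProjectiveResolution K).out
  have e : ((tensorComplex Q.complex).obj S.X₃).homology (i + 2) ≅
      ((tensorComplex Q.complex).obj S.X₁).homology (i + 1) :=
    (shortExact Q S hS).δIso (i + 2) (i + 1) rfl (isZero_homology Q S.X₂ (i + 1))
      (isZero_homology Q S.X₂ i)
  exact ⟨(torIso Q S.X₃ (i + 2) ≪≫ e ≪≫ (torIso Q S.X₁ (i + 1)).symm).toLinearEquiv⟩

theorem nonempty_tor_zero_equiv (M K : ModuleCat.{0} B) :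
    Nonempty (((Tor (ModuleCat.{0} B) 0).obj M).obj K ≃ₗ[B] TensorProduct B M K) :=
  ⟨(((tensoringLeft (ModuleCat.{0} B)).obj M).leftDerivedZeroIsoSelf.app K).toLinearEquiv⟩

theorem exact_conj {M₁ M₂ M₃ N₁ N₂ N₃ : Type*} [AddCommGroup M₁] [AddCommGroup M₂]
    [AddCommGroup M₃] [AddCommGroup N₁] [AddCommGroup N₂] [AddCommGroup N₃] [Module B M₁]
    [Module B M₂] [Module B M₃] [Module B N₁] [Module B N₂] [Module B N₃] (e₁ : N₁ ≃ₗ[B] M₁)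
    (e₂ : N₂ ≃ₗ[B] M₂) (e₃ : N₃ ≃ₗ[B] M₃) {u : M₁ →ₗ[B] M₂} {v : M₂ →ₗ[B] M₃}
    (h : Function.Exact u v) :
    Function.Exact ((e₂.symm.toLinearMap ∘ₗ u) ∘ₗ e₁.toLinearMap)
      ((e₃.symm.toLinearMap ∘ₗ v) ∘ₗ e₂.toLinearMap) := by
  intro y
  have := h (e₂ y)
  simp only [LinearMap.coe_comp, LinearEquiv.coe_coe, Function.comp_apply, Set.mem_range,
    LinearEquiv.symm_apply_eq, map_zero]
  refine this.trans ⟨fun ⟨x, hx⟩ => ⟨e₁.symm x, ?_⟩, fun ⟨x, hx⟩ => ⟨_, hx⟩⟩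
  rw [LinearEquiv.apply_symm_apply, hx]

theorem exists_tor_one_sequence (K : ModuleCat.{0} B) {S : ShortComplex (ModuleCat.{0} B)}
    (hS : S.ShortExact) [Module.Flat B S.X₂] :
    ∃ (δ : ((Tor (ModuleCat.{0} B) 1).obj S.X₃).obj K →ₗ[B]
          ((Tor (ModuleCat.{0} B) 0).obj S.X₁).obj K)
      (u : ((Tor (ModuleCat.{0} B) 0).obj S.X₁).obj K →ₗ[B]
        ((Tor (ModuleCat.{0} B) 0).obj S.X₂).obj K)
      (v : ((Tor (ModuleCat.{0} B) 0).obj S.X₂).obj K →ₗ[B]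
        ((Tor (ModuleCat.{0} B) 0).obj S.X₃).obj K),
      Function.Injective δ ∧ Function.Exact δ u ∧ Function.Exact u v ∧ Function.Surjective v := by
  obtain ⟨Q⟩ := (inferInstance : HasProjectiveResolution K).out
  have hQ := shortExact Q S hS
  have hmono := hQ.mono_δ 1 0 rfl (isZero_homology Q S.X₂ 0)
  have hepi₀ := hQ.epi_g
  have hepi : Epi (HomologicalComplex.homologyMap (S.map (tensorComplex Q.complex)).g 0) :=
    HomologicalComplex.epi_homologyMap_of_epi_of_not_rel _ _ (by simp)
  have h1 := hQ.homology_exact₁ 1 0 rfl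
  have h2 := hQ.homology_exact₂ 0
  rw [ShortComplex.ShortExact.moduleCat_exact_iff_function_exact] at h1 h2
  refine ⟨((torIso Q S.X₁ 0).toLinearEquiv.symm.toLinearMap ∘ₗ (hQ.δ 1 0 rfl).hom) ∘ₗ
      (torIso Q S.X₃ 1).toLinearEquiv.toLinearMap,
    ((torIso Q S.X₂ 0).toLinearEquiv.symm.toLinearMap ∘ₗ
      (HomologicalComplex.homologyMap (S.map (tensorComplex Q.complex)).f 0).hom) ∘ₗ
      (torIso Q S.X₁ 0).toLinearEquiv.toLinearMap,
    ((torIso Q S.X₃ 0).toLinearEquiv.symm.toLinearMap ∘ₗ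
      (HomologicalComplex.homologyMap (S.map (tensorComplex Q.complex)).g 0).hom) ∘ₗ
      (torIso Q S.X₂ 0).toLinearEquiv.toLinearMap, ?_, ?_, ?_, ?_⟩
  · exact ((torIso Q S.X₁ 0).toLinearEquiv.symm.injective.comp
      ((ModuleCat.mono_iff_injective _).1 hmono)).comp (torIso Q S.X₃ 1).toLinearEquiv.injective
  · exact exact_conj _ _ _ h1
  · exact exact_conj _ _ _ h2
  · exact ((torIso Q S.X₃ 0).toLinearEquiv.symm.surjective.comp
      ((ModuleCat.epi_iff_surjective _).1 hepi)).comp (torIso Q S.X₂ 0).toLinearEquiv.surjective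

variable {M : ModuleCat.{0} B} {N F : Type} [AddCommGroup N] [Module B N] [AddCommGroup F]
  [Module B F] {u : N →ₗ[B] F} {v : F →ₗ[B] M}

/-- The short exact sequence `0 → N → F → M → 0`. -/
def shortComplex (huv : Function.Exact u v) : ShortComplex (ModuleCat.{0} B) :=
  ShortComplex.mk (X₃ := M) (ModuleCat.ofHom u) (ModuleCat.ofHom v)
    (ModuleCat.hom_ext (LinearMap.ext huv.apply_apply_eq_zero))

theorem shortExact_shortComplex (hu : Function.Injective u) (huv : Function.Exact u v)
    (hv : Function.Surjective v) : (shortComplex huv).ShortExact where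
  exact := (ShortComplex.ShortExact.moduleCat_exact_iff_function_exact _).2 huv
  mono_f := (ModuleCat.mono_iff_injective _).2 hu
  epi_g := (ModuleCat.epi_iff_surjective _).2 hv

end TorSequence

/-! ### Minimal numbers of generators over local algebras -/

namespace LocalAlgebra

open IsLocalRing

section Dim

variable (κ : Type*) [Field κ]

/-- The dimension over `κ` of a module over a `κ`-algebra. -/
def dim (B M : Type*) [CommRing B] [Algebra κ B] [AddCommGroup M] [Module B M] : ℕ :=
  Module.finrank κ (RestrictScalars κ B M)

variable {κ} {B : Type*} [CommRing B] [Algebra κ B]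
  {M N P : Type*} [AddCommGroup M] [Module B M] [AddCommGroup N] [Module B N]
  [AddCommGroup P] [Module B P]

theorem dim_eq_finrank [Module κ M] [IsScalarTower κ B M] : dim κ B M = Module.finrank κ M :=
  LinearEquiv.finrank_eq
    { RestrictScalars.addEquiv κ B M with
      map_smul' := fun c x => algebraMap_smul B c (RestrictScalars.addEquiv κ B M x) }

theorem dim_congr (e : M ≃ₗ[B] N) : dim κ B M = dim κ B N := by
  let _ : Module κ M := Module.compHom M (algebraMap κ B)
  let _ : Module κ N := Module.compHom N (algebraMap κ B)
  have _ : IsScalarTower κ B M := IsScalarTower.of_algebraMap_smul fun _ _ => rfl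
  have _ : IsScalarTower κ B N := IsScalarTower.of_algebraMap_smul fun _ _ => rfl
  rw [dim_eq_finrank, dim_eq_finrank]
  exact (e.restrictScalars κ).finrank_eq

theorem dim_restrictScalars {A : Type*} [CommRing A] [Algebra κ A] [Algebra A B]
    [IsScalarTower κ A B] [Module A M] [IsScalarTower A B M] : dim κ A M = dim κ B M := by
  let _ : Module κ M := Module.compHom M (algebraMap κ B)
  have _ : IsScalarTower κ B M := IsScalarTower.of_algebraMap_smul fun _ _ => rfl
  have _ : IsScalarTower κ A M := IsScalarTower.of_algebraMap_smul fun c x => by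
    rw [← algebraMap_smul B (algebraMap κ A c) x, ← IsScalarTower.algebraMap_apply]
    rfl
  rw [dim_eq_finrank, dim_eq_finrank]

variable (κ B M) in
/-- Finite dimensionality over `κ` of a module over a `κ`-algebra. -/
def FiniteDim : Prop := Module.Finite κ (RestrictScalars κ B M)

theorem finiteDim_iff [Module κ M] [IsScalarTower κ B M] :
    FiniteDim κ B M ↔ Module.Finite κ M :=
  Module.Finite.equiv_iff
    { RestrictScalars.addEquiv κ B M with
      map_smul' := fun c x => algebraMap_smul B c (RestrictScalars.addEquiv κ B M x) }

theorem FiniteDim.of_surjective (h : FiniteDim κ B M) (v : M →ₗ[B] N)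
    (hv : Function.Surjective v) : FiniteDim κ B N := by
  let _ : Module κ M := Module.compHom M (algebraMap κ B)
  let _ : Module κ N := Module.compHom N (algebraMap κ B)
  have _ : IsScalarTower κ B M := IsScalarTower.of_algebraMap_smul fun _ _ => rfl
  have _ : IsScalarTower κ B N := IsScalarTower.of_algebraMap_smul fun _ _ => rfl
  rw [finiteDim_iff] at h ⊢
  exact Module.Finite.of_surjective (v.restrictScalars κ) hv

theorem dim_add_of_exact (h : FiniteDim κ B N) {u : M →ₗ[B] N} {v : N →ₗ[B] P}
    (hu : Function.Injective u) (huv : Function.Exact u v) (hv : Function.Surjective v) :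
    dim κ B N = dim κ B M + dim κ B P := by
  let _ : Module κ M := Module.compHom M (algebraMap κ B)
  let _ : Module κ N := Module.compHom N (algebraMap κ B)
  let _ : Module κ P := Module.compHom P (algebraMap κ B)
  have _ : IsScalarTower κ B M := IsScalarTower.of_algebraMap_smul fun _ _ => rfl
  have _ : IsScalarTower κ B N := IsScalarTower.of_algebraMap_smul fun _ _ => rfl
  have _ : IsScalarTower κ B P := IsScalarTower.of_algebraMap_smul fun _ _ => rfl
  rw [finiteDim_iff] at h
  rw [dim_eq_finrank, dim_eq_finrank, dim_eq_finrank,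
    ← LinearMap.finrank_range_add_finrank_ker (v.restrictScalars κ),
    LinearMap.range_eq_top.2 (show Function.Surjective (v.restrictScalars κ) from hv),
    finrank_top, add_comm, LinearMap.exact_iff.1 (show Function.Exact (u.restrictScalars κ)
      (v.restrictScalars κ) from huv),
    LinearMap.finrank_range_of_inj (f := u.restrictScalars κ) hu]

/-- Converse to `dim_add_of_exact`, by rank–nullity: additivity of dimensions leaves no room for a
kernel of `u`. It turns numerical hypotheses into left exactness. -/
theorem injective_of_dim_eq (hM : FiniteDim κ B M) {u : M →ₗ[B] N} {v : N →ₗ[B] P}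
    (hN : FiniteDim κ B N) (huv : Function.Exact u v) (hv : Function.Surjective v)
    (h : dim κ B N = dim κ B M + dim κ B P) : Function.Injective u := by
  let _ : Module κ M := Module.compHom M (algebraMap κ B)
  let _ : Module κ N := Module.compHom N (algebraMap κ B)
  let _ : Module κ P := Module.compHom P (algebraMap κ B)
  have _ : IsScalarTower κ B M := IsScalarTower.of_algebraMap_smul fun _ _ => rfl
  have _ : IsScalarTower κ B N := IsScalarTower.of_algebraMap_smul fun _ _ => rfl
  have _ : IsScalarTower κ B P := IsScalarTower.of_algebraMap_smul fun _ _ => rfl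
  rw [finiteDim_iff] at hM hN
  rw [dim_eq_finrank, dim_eq_finrank, dim_eq_finrank,
    ← LinearMap.finrank_range_add_finrank_ker (v.restrictScalars κ),
    LinearMap.range_eq_top.2 (show Function.Surjective (v.restrictScalars κ) from hv),
    finrank_top, add_comm, LinearMap.exact_iff.1 (show Function.Exact (u.restrictScalars κ)
      (v.restrictScalars κ) from huv),
    ← LinearMap.finrank_range_add_finrank_ker (u.restrictScalars κ)] at h
  have h0 : Module.finrank κ (LinearMap.ker (u.restrictScalars κ)) = 0 := by omega
  exact (LinearMap.ker_eq_bot (f := u.restrictScalars κ)).1 (Submodule.finrank_eq_zero.1 h0)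

end Dim

section GenRank

variable (κ : Type*) [Field κ]

/-- The dimension of `M / 𝔪 M`, the minimal number of generators of `M`. -/
def genRank (B M : Type*) [CommRing B] [IsLocalRing B] [Algebra κ B] [AddCommGroup M]
    [Module B M] : ℕ :=
  dim κ B (M ⧸ (maximalIdeal B • ⊤ : Submodule B M))

/-- The residue field of the `κ`-algebra `B` is `κ`. -/
def IsRational (B : Type*) [CommRing B] [IsLocalRing B] [Algebra κ B] : Prop :=
  ∀ b : B, ∃ c : κ, b - algebraMap κ B c ∈ maximalIdeal B

variable {κ} {B : Type*} [CommRing B] [IsLocalRing B] [Algebra κ B]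
  {M N P : Type*} [AddCommGroup M] [Module B M] [AddCommGroup N] [Module B N]
  [AddCommGroup P] [Module B P]

theorem genRank_congr (e : M ≃ₗ[B] N) : genRank κ B M = genRank κ B N :=
  dim_congr (Submodule.Quotient.equiv _ _ e (by
    rw [Submodule.map_smul'', Submodule.map_top]
    exact congrArg _ e.range))

/-- On `M / 𝔪 M` the ring acts through its residue field `κ`, so generators over `B` already span
over `κ`. Without finiteness, `finrank` would default to 0. -/
theorem finiteDim_quotient (hB : IsRational κ B) [Module.Finite B M] :
    FiniteDim κ B (M ⧸ (maximalIdeal B • ⊤ : Submodule B M)) := by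
  let _ : Module κ (M ⧸ (maximalIdeal B • ⊤ : Submodule B M)) :=
    Module.compHom _ (algebraMap κ B)
  have _ : IsScalarTower κ B (M ⧸ (maximalIdeal B • ⊤ : Submodule B M)) :=
    IsScalarTower.of_algebraMap_smul fun _ _ => rfl
  rw [finiteDim_iff]
  obtain ⟨s, hs⟩ := Module.Finite.fg_top (R := B) (M := M ⧸ (maximalIdeal B • ⊤ : Submodule B M))
  refine ⟨s, top_le_iff.1 fun x _ => ?_⟩
  have hx : x ∈ Submodule.span B (s : Set (M ⧸ (maximalIdeal B • ⊤ : Submodule B M))) :=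
    hs ▸ Submodule.mem_top
  induction hx using Submodule.span_induction with
  | mem x hx => exact Submodule.subset_span hx
  | zero => exact zero_mem _
  | add x y _ _ hx hy => exact add_mem (hx trivial) (hy trivial)
  | smul b x _ hx =>
    obtain ⟨c, hc⟩ := hB b
    have h0 : (b - algebraMap κ B c) • x = 0 := by
      obtain ⟨x, rfl⟩ := Submodule.mkQ_surjective _ x
      rw [← map_smul, Submodule.mkQ_apply, Submodule.Quotient.mk_eq_zero]
      exact Submodule.smul_mem_smul hc Submodule.mem_top
    rw [sub_smul, sub_eq_zero, algebraMap_smul] at h0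
    rw [h0]
    exact Submodule.smul_mem _ c (hx trivial)

/-- The map `M / 𝔪 M → N / 𝔪 N` induced by a linear map. -/
def quotMap (u : M →ₗ[B] N) : (M ⧸ (maximalIdeal B • ⊤ : Submodule B M)) →ₗ[B]
    N ⧸ (maximalIdeal B • ⊤ : Submodule B N) :=
  Submodule.mapQ _ _ u (by
    rw [← Submodule.map_le_iff_le_comap, Submodule.map_smul'']
    exact Submodule.smul_mono le_rfl le_top)

theorem quotMap_surjective {u : M →ₗ[B] N} (hu : Function.Surjective u) :
    Function.Surjective (quotMap u) := by
  intro y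
  obtain ⟨y, rfl⟩ := Submodule.mkQ_surjective _ y
  obtain ⟨x, rfl⟩ := hu y
  exact ⟨Submodule.mkQ _ x, rfl⟩

theorem quotMap_exact {u : M →ₗ[B] N} {v : N →ₗ[B] P} (huv : Function.Exact u v)
    (hv : Function.Surjective v) : Function.Exact (quotMap u) (quotMap v) := by
  intro y
  constructor
  · obtain ⟨y, rfl⟩ := Submodule.mkQ_surjective _ y
    intro hy
    have hy : v y ∈ (maximalIdeal B • ⊤ : Submodule B P) :=
      (Submodule.Quotient.mk_eq_zero _).1 hy
    rw [← LinearMap.range_eq_top.2 hv, ← Submodule.map_top, ← Submodule.map_smul''] at hy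
    obtain ⟨z, hz, hzy⟩ := hy
    obtain ⟨x, hx⟩ := (huv (y - z)).1 (by rw [map_sub, hzy, sub_self])
    refine ⟨Submodule.mkQ _ x, ?_⟩
    change Submodule.Quotient.mk (u x) = Submodule.Quotient.mk y
    rw [Submodule.Quotient.eq, hx, sub_sub_cancel_left]
    exact neg_mem hz
  · rintro ⟨x, rfl⟩
    obtain ⟨x, rfl⟩ := Submodule.mkQ_surjective _ x
    change Submodule.Quotient.mk (v (u x)) = 0
    rw [huv.apply_apply_eq_zero, Submodule.Quotient.mk_zero]

theorem quotMap_injective_iff {u : M →ₗ[B] N} : Function.Injective (quotMap u) ↔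
    ∀ x, u x ∈ (maximalIdeal B • ⊤ : Submodule B N) → x ∈ (maximalIdeal B • ⊤ : Submodule B M) := by
  rw [injective_iff_map_eq_zero]
  constructor
  · intro h x hx
    exact (Submodule.Quotient.mk_eq_zero _).1 (h (Submodule.mkQ _ x)
      ((Submodule.Quotient.mk_eq_zero _).2 hx))
  · intro h x hx
    obtain ⟨x, rfl⟩ := Submodule.mkQ_surjective _ x
    exact (Submodule.Quotient.mk_eq_zero _).2 (h x ((Submodule.Quotient.mk_eq_zero _).1 hx))

theorem genRank_add_of_exact (hB : IsRational κ B) [Module.Finite B N] {u : M →ₗ[B] N}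
    {v : N →ₗ[B] P} (huv : Function.Exact u v) (hv : Function.Surjective v)
    (h : ∀ x, u x ∈ (maximalIdeal B • ⊤ : Submodule B N) →
      x ∈ (maximalIdeal B • ⊤ : Submodule B M)) :
    genRank κ B N = genRank κ B M + genRank κ B P :=
  dim_add_of_exact (finiteDim_quotient hB) (quotMap_injective_iff.2 h) (quotMap_exact huv hv)
    (quotMap_surjective hv)

/-- Applied to kernels inside maximal ideals: an equality of embedding dimensions becomes `ker ∩ 𝔪²
= 𝔪 ker`. -/
theorem mem_smul_of_genRank_eq (hB : IsRational κ B) [Module.Finite B M] [Module.Finite B N]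
    {u : M →ₗ[B] N} {v : N →ₗ[B] P} (huv : Function.Exact u v) (hv : Function.Surjective v)
    (h : genRank κ B N = genRank κ B M + genRank κ B P) (x : M)
    (hx : u x ∈ (maximalIdeal B • ⊤ : Submodule B N)) :
    x ∈ (maximalIdeal B • ⊤ : Submodule B M) :=
  quotMap_injective_iff.1 (injective_of_dim_eq (finiteDim_quotient hB) (finiteDim_quotient hB)
    (quotMap_exact huv hv) (quotMap_surjective hv) h) x hx

theorem genRank_eq_of_ker_le {v : N →ₗ[B] P} (hv : Function.Surjective v)
    (h : LinearMap.ker v ≤ maximalIdeal B • ⊤) : genRank κ B N = genRank κ B P := by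
  refine dim_congr (LinearEquiv.ofBijective (quotMap v) ⟨?_, quotMap_surjective hv⟩)
  rw [quotMap_injective_iff]
  intro x hx
  rw [← LinearMap.range_eq_top.2 hv, ← Submodule.map_top, ← Submodule.map_smul''] at hx
  obtain ⟨z, hz, hzx⟩ := hx
  have : x - z ∈ LinearMap.ker v := by rw [LinearMap.mem_ker, map_sub, hzx, sub_self]
  rw [← sub_add_cancel x z]
  exact add_mem (h this) hz

theorem genRank_self (hB : IsRational κ B) : genRank κ B B = 1 := by
  have htop : (maximalIdeal B • ⊤ : Submodule B B) = maximalIdeal B := by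
    rw [smul_eq_mul, Ideal.mul_top]
  rw [genRank, dim_eq_finrank, finrank_eq_one_iff']
  refine ⟨Submodule.mkQ _ 1, ?_, fun w => ?_⟩
  · rw [Submodule.mkQ_apply, Ne, Submodule.Quotient.mk_eq_zero, htop]
    exact (Ideal.ne_top_iff_one _).1 (maximalIdeal.isMaximal B).ne_top
  · obtain ⟨b, rfl⟩ := Submodule.mkQ_surjective _ w
    obtain ⟨c, hc⟩ := hB b
    refine ⟨c, ?_⟩
    rw [← algebraMap_smul B c (Submodule.mkQ _ (1 : B)), ← map_smul,
      smul_eq_mul (algebraMap κ B c) 1, mul_one,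
      eq_comm, Submodule.mkQ_apply,
      Submodule.mkQ_apply, Submodule.Quotient.eq, htop]
    exact hc

theorem restrictScalars_smul_top {A : Type*} [CommRing A] [IsLocalRing A] [Algebra A B]
    [Module A M] [IsScalarTower A B M] (hAB : Function.Surjective (algebraMap A B)) :
    (maximalIdeal B • ⊤ : Submodule B M).restrictScalars A = maximalIdeal A • ⊤ := by
  rw [← map_maximalIdeal_of_surjective _ hAB, Ideal.smul_restrictScalars,
    Submodule.restrictScalars_top]

theorem genRank_restrictScalars {A : Type*} [CommRing A] [IsLocalRing A] [Algebra κ A]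
    [Algebra A B] [IsScalarTower κ A B] [Module A M] [IsScalarTower A B M]
    (hAB : Function.Surjective (algebraMap A B)) : genRank κ A M = genRank κ B M := by
  rw [genRank, genRank, ← dim_restrictScalars (A := A) (B := B), ← restrictScalars_smul_top hAB]
  exact dim_congr (Submodule.Quotient.restrictScalarsEquiv A _)

theorem pi_mem_smul_top {n : ℕ} {x : Fin n → M}
    (hx : ∀ i, x i ∈ (maximalIdeal B • ⊤ : Submodule B M)) :
    x ∈ (maximalIdeal B • ⊤ : Submodule B (Fin n → M)) := by
  rw [← Finset.univ_sum_single x]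
  refine Submodule.sum_mem _ fun i _ => ?_
  have := Submodule.mem_map_of_mem (f := LinearMap.single B (fun _ : Fin n => M) i) (hx i)
  rw [Submodule.map_smul''] at this
  exact Submodule.smul_mono le_rfl le_top this

theorem map_mem_smul_top (u : M →ₗ[B] N) {x : M}
    (hx : x ∈ (maximalIdeal B • ⊤ : Submodule B M)) :
    u x ∈ (maximalIdeal B • ⊤ : Submodule B N) := by
  have := Submodule.mem_map_of_mem (f := u) hx
  rw [Submodule.map_smul''] at this
  exact Submodule.smul_mono le_rfl le_top this

theorem genRank_fin (hB : IsRational κ B) [Module.Finite B M] (n : ℕ) :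
    genRank κ B (Fin n → M) = n * genRank κ B M := by
  induction n with
  | zero =>
    rw [zero_mul, genRank, dim]
    have : Subsingleton (RestrictScalars κ B
        ((Fin 0 → M) ⧸ (maximalIdeal B • ⊤ : Submodule B (Fin 0 → M)))) :=
      inferInstanceAs (Subsingleton
        ((Fin 0 → M) ⧸ (maximalIdeal B • ⊤ : Submodule B (Fin 0 → M))))
    exact Module.finrank_zero_of_subsingleton
  | succ n ih =>
    rw [genRank_add_of_exact hB (u := LinearMap.single B (fun _ : Fin (n + 1) => M) 0)
      (v := LinearMap.funLeft B M Fin.succ), ih]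
    · ring
    · intro x
      constructor
      · intro hx
        refine ⟨x 0, funext fun i => ?_⟩
        refine Fin.cases ?_ (fun j => ?_) i
        · simp
        · simpa using (congrFun hx j).symm
      · rintro ⟨y, rfl⟩
        ext j
        simp [LinearMap.funLeft_apply]
    · exact LinearMap.funLeft_surjective_of_injective _ _ _ (Fin.succ_injective n)
    · intro x hx
      simpa using map_mem_smul_top (LinearMap.proj (R := B) (φ := fun _ : Fin (n + 1) => M) 0) hx

theorem genRank_ne_zero (hB : IsRational κ B) [Module.Finite B M] [Nontrivial M] :
    genRank κ B M ≠ 0 := by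
  intro h0
  have hfin := finiteDim_quotient (κ := κ) (M := M) hB
  let _ : Module κ (M ⧸ (maximalIdeal B • ⊤ : Submodule B M)) :=
    Module.compHom _ (algebraMap κ B)
  have _ : IsScalarTower κ B (M ⧸ (maximalIdeal B • ⊤ : Submodule B M)) :=
    IsScalarTower.of_algebraMap_smul fun _ _ => rfl
  rw [finiteDim_iff] at hfin
  rw [genRank, dim_eq_finrank, Module.finrank_zero_iff,
    Submodule.Quotient.subsingleton_iff] at h0
  have : (⊤ : Submodule B M) = ⊥ := Submodule.eq_bot_of_le_smul_of_le_jacobson_bot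
    (maximalIdeal B) ⊤ Module.Finite.fg_top h0.ge (IsLocalRing.maximalIdeal_le_jacobson _)
  exact top_ne_bot this

/-- Existence of a minimal system of generators. -/
theorem exists_minimal_generators (hB : IsRational κ B) [Module.Finite B M] :
    ∃ x : Fin (genRank κ B M) → M, Function.Surjective (Fintype.linearCombination B x) ∧
      ∀ b, Fintype.linearCombination B x b = 0 → ∀ i, b i ∈ maximalIdeal B := by
  have hfin := finiteDim_quotient (κ := κ) (M := M) hB
  let _ : Module κ (M ⧸ (maximalIdeal B • ⊤ : Submodule B M)) :=
    Module.compHom _ (algebraMap κ B)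
  have _ : IsScalarTower κ B (M ⧸ (maximalIdeal B • ⊤ : Submodule B M)) :=
    IsScalarTower.of_algebraMap_smul fun _ _ => rfl
  rw [finiteDim_iff] at hfin
  have hrank : genRank κ B M = Module.finrank κ (M ⧸ (maximalIdeal B • ⊤ : Submodule B M)) :=
    dim_eq_finrank
  rw [hrank]
  let e := Module.finBasis κ (M ⧸ (maximalIdeal B • ⊤ : Submodule B M))
  choose x hx using fun i => Submodule.mkQ_surjective _ (e i)
  refine ⟨x, ?_, ?_⟩
  -- By Nakayama it suffices that the lifts of a basis of `M / 𝔪 M` generate modulo `𝔪 M`.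
  · rw [← LinearMap.range_eq_top, ← map_mkQ_eq_top, Fintype.range_linearCombination,
      Submodule.map_span, ← Set.range_comp]
    have : (Submodule.mkQ (maximalIdeal B • ⊤ : Submodule B M)) ∘ x = e := funext hx
    rw [this, eq_top_iff]
    intro y _
    rw [← e.sum_repr y]
    refine Submodule.sum_mem _ fun i _ => ?_
    rw [← algebraMap_smul B (e.repr y i) (e i)]
    exact Submodule.smul_mem _ _ (Submodule.subset_span ⟨i, rfl⟩)
  · intro b hb i
    choose c hc using hB
    have h0 : ∑ i, c (b i) • e i = 0 := by
      have h1 : ∀ i, c (b i) • e i = Submodule.mkQ (maximalIdeal B • ⊤ : Submodule B M)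
          (b i • x i) := by
        intro i
        rw [← hx i, ← algebraMap_smul B (c (b i)) (Submodule.mkQ _ (x i)), ← map_smul, eq_comm, ← sub_eq_zero, ← map_sub,
          ← sub_smul, Submodule.mkQ_apply, Submodule.Quotient.mk_eq_zero]
        exact Submodule.smul_mem_smul (hc _) Submodule.mem_top
      simp_rw [h1, ← map_sum]
      rw [Fintype.linearCombination_apply] at hb
      rw [hb, map_zero]
    have h2 : c (b i) = 0 := Fintype.linearIndependent_iff.1 e.linearIndependent _ h0 i
    have := hc (b i)
    rwa [h2, map_zero, sub_zero] at this

end GenRank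

end LocalAlgebra

namespace LocalAlgebra

open IsLocalRing

/-! ### Betti numbers in low degrees -/

section Betti

open TorSequence

variable (κ : Type*) [Field κ] {B : Type} [CommRing B] [IsLocalRing B] [Algebra κ B]

/-- The dimension of `Tor i M k`, where `k` is the residue field. -/
def betti (M : ModuleCat.{0} B) (i : ℕ) : ℕ :=
  dim κ B (((Tor (ModuleCat.{0} B) i).obj M).obj (ModuleCat.of B (ResidueField B)))

variable {κ}

theorem betti_congr {M N : ModuleCat.{0} B} (e : M ≅ N) (i : ℕ) : betti κ M i = betti κ N i :=
  dim_congr (((Tor (ModuleCat.{0} B) i).mapIso e).app _).toLinearEquiv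

theorem nonempty_tor_zero_equiv_quotient (M : ModuleCat.{0} B) :
    Nonempty (((Tor (ModuleCat.{0} B) 0).obj M).obj (ModuleCat.of B (ResidueField B)) ≃ₗ[B]
      (M ⧸ (maximalIdeal B • ⊤ : Submodule B M))) := by
  obtain ⟨e⟩ := TorSequence.nonempty_tor_zero_equiv M (ModuleCat.of B (ResidueField B))
  exact ⟨e ≪≫ₗ TensorProduct.tensorQuotEquivQuotSMul M (maximalIdeal B)⟩

theorem betti_zero (M : ModuleCat.{0} B) : betti κ M 0 = genRank κ B M := by
  obtain ⟨e⟩ := nonempty_tor_zero_equiv_quotient M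
  exact dim_congr e

variable {M : ModuleCat.{0} B} {N F : Type} [AddCommGroup N] [Module B N] [AddCommGroup F]
  [Module B F] {u : N →ₗ[B] F} {v : F →ₗ[B] M}

theorem betti_add_two [Module.Flat B F] (hu : Function.Injective u) (huv : Function.Exact u v)
    (hv : Function.Surjective v) (i : ℕ) :
    betti κ M (i + 2) = betti κ (ModuleCat.of B N) (i + 1) := by
  have : Module.Flat B (shortComplex huv).X₂ := ‹Module.Flat B F›
  obtain ⟨e⟩ := TorSequence.nonempty_tor_equiv (ModuleCat.of B (ResidueField B))
    (shortExact_shortComplex hu huv hv) i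
  exact dim_congr e

/-- Minimality makes `F / 𝔪 F → M / 𝔪 M` bijective, so `N / 𝔪 N → F / 𝔪 F` is zero and the
connecting map `Tor_1(M, k) → N / 𝔪 N` is an isomorphism. -/
theorem betti_one (hB : IsRational κ B) [Module.Flat B F] [Module.Finite B F]
    (hu : Function.Injective u) (huv : Function.Exact u v) (hv : Function.Surjective v)
    (hker : LinearMap.ker v ≤ maximalIdeal B • ⊤) : betti κ M 1 = genRank κ B N := by
  have : Module.Flat B (shortComplex huv).X₂ := ‹Module.Flat B F›
  obtain ⟨δ, p, q, hδ, hδp, hpq, hq⟩ := TorSequence.exists_tor_one_sequence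
    (ModuleCat.of B (ResidueField B)) (shortExact_shortComplex hu huv hv)
  obtain ⟨e₁⟩ := nonempty_tor_zero_equiv_quotient (ModuleCat.of B N)
  obtain ⟨e₂⟩ := nonempty_tor_zero_equiv_quotient (ModuleCat.of B F)
  obtain ⟨e₃⟩ := nonempty_tor_zero_equiv_quotient M
  have hfin : FiniteDim κ B (((Tor (ModuleCat.{0} B) 0).obj (ModuleCat.of B F)).obj
      (ModuleCat.of B (ResidueField B))) :=
    (finiteDim_quotient (M := F) hB).of_surjective e₂.symm.toLinearMap e₂.symm.surjective
  have hdim : dim κ B (((Tor (ModuleCat.{0} B) 0).obj (ModuleCat.of B F)).obj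
      (ModuleCat.of B (ResidueField B))) = dim κ B (((Tor (ModuleCat.{0} B) 0).obj M).obj
      (ModuleCat.of B (ResidueField B))) := by
    rw [dim_congr e₂, dim_congr e₃]
    exact genRank_eq_of_ker_le hv hker
  have hq' : Function.Injective q := by
    refine injective_of_dim_eq (v := (0 : _ →ₗ[B] PUnit.{1})) hfin
      (hfin.of_surjective q hq) ?_ (fun _ => ⟨0, rfl⟩) ?_
    · intro y
      exact ⟨fun _ => hq y, fun _ => rfl⟩
    · have : Subsingleton (RestrictScalars κ B PUnit.{1}) := inferInstanceAs (Subsingleton PUnit.{1})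
      have h0 : dim κ B PUnit.{1} = 0 := Module.finrank_zero_of_subsingleton
      rw [h0, add_zero]
      exact hdim.symm
  have hp : ∀ x, p x = 0 := fun x => hq' (by rw [hpq.apply_apply_eq_zero, map_zero])
  have hδs : Function.Surjective δ := fun x => (hδp x).1 (hp x)
  exact (dim_congr (LinearEquiv.ofBijective δ ⟨hδ, hδs⟩)).trans (dim_congr e₁)

end Betti

/-! ### Betti numbers of cyclic modules and the embedding dimension -/

section Cyclic

variable {κ : Type*} [Field κ] {B : Type} [CommRing B] [IsLocalRing B] [Algebra κ B]
  {M : ModuleCat.{0} B} {v : B →ₗ[B] M}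

theorem ker_le_smul_top [Nontrivial M] (hv : Function.Surjective v) :
    LinearMap.ker v ≤ maximalIdeal B • ⊤ := by
  rw [smul_eq_mul, Ideal.mul_top]
  refine le_maximalIdeal fun htop => ?_
  obtain ⟨x, hx⟩ := exists_ne (0 : M)
  obtain ⟨b, rfl⟩ := hv x
  exact hx (show b ∈ LinearMap.ker v by rw [htop]; trivial)

theorem betti_zero_cyclic (hB : IsRational κ B) [Nontrivial M] (hv : Function.Surjective v) :
    betti κ M 0 = 1 := by
  rw [betti_zero, ← genRank_eq_of_ker_le hv (ker_le_smul_top hv), genRank_self hB]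

theorem betti_one_cyclic (hB : IsRational κ B) [Nontrivial M] (hv : Function.Surjective v)
    {I : Ideal B} (hI : ∀ b, b ∈ I ↔ v b = 0) : betti κ M 1 = genRank κ B I := by
  obtain rfl : LinearMap.ker v = I := Submodule.ext fun b => (hI b).symm
  exact betti_one hB (Submodule.subtype_injective _) (LinearMap.exact_subtype_ker_map v) hv
    (ker_le_smul_top hv)

theorem betti_two_cyclic (hv : Function.Surjective v) {I : Ideal B}
    (hI : ∀ b, b ∈ I ↔ v b = 0) : betti κ M 2 = betti κ (ModuleCat.of B I) 1 := by
  obtain rfl : LinearMap.ker v = I := Submodule.ext fun b => (hI b).symm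
  exact betti_add_two (Submodule.subtype_injective _) (LinearMap.exact_subtype_ker_map v) hv 0

theorem genRank_maximalIdeal (hB : IsRational κ B) :
    genRank κ B (maximalIdeal B) =
      Module.finrank (ResidueField B) (CotangentSpace B) := by
  have h1 : Module.finrank κ (ResidueField B) = 1 := by
    rw [finrank_eq_one_iff']
    refine ⟨1, one_ne_zero, fun w => ?_⟩
    obtain ⟨b, rfl⟩ := residue_surjective w
    obtain ⟨c, hc⟩ := hB b
    refine ⟨c, ?_⟩
    rw [← Algebra.algebraMap_eq_smul_one, IsScalarTower.algebraMap_apply κ B, eq_comm,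
      ResidueField.algebraMap_eq, ← sub_eq_zero, ← map_sub, residue_eq_zero_iff]
    exact hc
  have _ : IsScalarTower κ (ResidueField B) (CotangentSpace B) :=
    IsScalarTower.of_algebraMap_smul fun c x => by
      rw [IsScalarTower.algebraMap_apply κ B, algebraMap_smul, algebraMap_smul]
  have h2 := Module.finrank_mul_finrank κ (ResidueField B) (CotangentSpace B)
  rw [h1, one_mul] at h2
  rw [h2, ← dim_eq_finrank (B := B)]
  rfl

end Cyclic

/-- In low degrees, the Betti numbers of a module over a quotient `B` of `A` behave as for a large
homomorphism, if the embedding dimensions do. -/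
theorem betti_one_of_large {κ : Type*} [Field κ] {A B : Type} [CommRing A] [CommRing B]
    [IsLocalRing A] [IsLocalRing B] [IsNoetherianRing A] [IsNoetherianRing B] [Algebra κ A]
    [Algebra κ B] [Algebra A B] [IsScalarTower κ A B] (hA : IsRational κ A) (hB : IsRational κ B)
    (hAB : Function.Surjective (algebraMap A B))
    (hK : ∀ x : RingHom.ker (algebraMap A B), x.1 ∈ maximalIdeal A * maximalIdeal A →
      x ∈ (maximalIdeal A • ⊤ : Submodule A (RingHom.ker (algebraMap A B))))
    {M : Type} [AddCommGroup M] [Module A M] [Module B M] [IsScalarTower A B M]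
    [Module.Finite B M] :
    betti κ (ModuleCat.of A M) 1 = betti κ (ModuleCat.of B M) 1 +
      genRank κ B M * genRank κ A (RingHom.ker (algebraMap A B)) := by
  have hloc : IsLocalHom (algebraMap A B) := .of_surjective _ hAB
  obtain ⟨x, hx, hmin⟩ := exists_minimal_generators (M := M) hB
  have hcomp : ∀ b : Fin (genRank κ B M) → A, Fintype.linearCombination A x b =
      Fintype.linearCombination B x (fun i => algebraMap A B (b i)) := fun b => by
    simp only [Fintype.linearCombination_apply, algebraMap_smul]
  have hxA : Function.Surjective (Fintype.linearCombination A x) := fun y => by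
    obtain ⟨b, rfl⟩ := hx y
    choose a ha using fun i => hAB (b i)
    exact ⟨a, by rw [hcomp]; exact congrArg _ (funext ha)⟩
  -- A system of generators minimal over `B` stays minimal over `A`, because `𝔪_A` is the preimage
  -- of `𝔪_B`.
  have hminA : ∀ b, Fintype.linearCombination A x b = 0 → ∀ i, b i ∈ maximalIdeal A :=
    fun b hb i => by
      rw [← maximalIdeal_comap (algebraMap A B)]
      exact hmin _ (hcomp b ▸ hb) i
  have hsmul : ∀ {C : Type} [CommRing C] [IsLocalRing C] (b : Fin (genRank κ B M) → C),
      (∀ i, b i ∈ maximalIdeal C) → b ∈ (maximalIdeal C • ⊤ : Submodule C (Fin (genRank κ B M) → C)) :=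
    fun b hb => pi_mem_smul_top fun i => by
      rw [smul_eq_mul, Ideal.mul_top]
      exact hb i
  rw [betti_one (M := ModuleCat.of A M) hA (Submodule.subtype_injective _)
      (LinearMap.exact_subtype_ker_map (Fintype.linearCombination A x)) hxA
      fun b hb => hsmul b (hminA b hb),
    betti_one (M := ModuleCat.of B M) hB (Submodule.subtype_injective _)
      (LinearMap.exact_subtype_ker_map (Fintype.linearCombination B x)) hx
      fun b hb => hsmul b (hmin b hb)]
  rw [← genRank_restrictScalars (A := A)
    (M := LinearMap.ker (Fintype.linearCombination B x)) hAB, ← genRank_fin hA, add_comm]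
  -- With `K = ker (A → B)` and `n` generators, the syzygies over `A` and `B` form an exact sequence
  -- `0 → K^n → Syz_A → Syz_B → 0`; it remains to see that it stays exact modulo `𝔪_A`.
  let p : LinearMap.ker (Fintype.linearCombination A x) →ₗ[A]
      LinearMap.ker (Fintype.linearCombination B x) :=
    { toFun b := ⟨fun i => algebraMap A B (b.1 i), by
        rw [LinearMap.mem_ker, ← hcomp]; exact b.2⟩
      map_add' b c := by ext i; simp
      map_smul' a b := by ext i; simp [Algebra.smul_def] }
  let u : (Fin (genRank κ B M) → RingHom.ker (algebraMap A B)) →ₗ[A]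
      LinearMap.ker (Fintype.linearCombination A x) :=
    { toFun b := ⟨fun i => (b i).1, by
        rw [LinearMap.mem_ker, hcomp]
        have : (fun i => algebraMap A B (b i).1) = 0 := funext fun i => (b i).2
        rw [this, map_zero]⟩
      map_add' b c := rfl
      map_smul' a b := rfl }
  refine genRank_add_of_exact hA (u := u) (v := p) ?_ ?_ ?_
  · intro b
    constructor
    · intro hb
      exact ⟨fun i => ⟨b.1 i, congrFun (congrArg Subtype.val hb) i⟩, rfl⟩
    · rintro ⟨b, rfl⟩
      ext i
      exact (b i).2
  · intro b
    choose a ha using fun i => hAB (b.1 i)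
    refine ⟨⟨a, ?_⟩, Subtype.ext (funext ha)⟩
    rw [LinearMap.mem_ker, hcomp, funext ha]
    exact b.2
  -- By minimality `Syz_A` has coordinates in `𝔪_A`, so elements of `𝔪_A Syz_A` have coordinates in
  -- `𝔪_A²`, where `hK` applies.
  · intro b hb
    refine pi_mem_smul_top fun i => hK _ ?_
    let w : LinearMap.ker (Fintype.linearCombination A x) →ₗ[A] A :=
      LinearMap.proj (R := A) (φ := fun _ : Fin (genRank κ B M) => A) i ∘ₗ Submodule.subtype _
    have h1 := Submodule.mem_map_of_mem (f := w) hb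
    rw [Submodule.map_smul''] at h1
    refine Submodule.smul_mono le_rfl ?_ h1
    rintro _ ⟨c, _, rfl⟩
    exact hminA c.1 c.2 i

end LocalAlgebra

namespace AnalyticGerm

open IsLocalRing LocalAlgebra

/-! ### Betti numbers of germs -/

theorem isRational_stalk (X : AnalyticGerm) : IsRational ℂ X.stalk :=
  X.exists_sub_algebraMap_mem

theorem edim_eq (X : AnalyticGerm) : X.edim = genRank ℂ X.stalk (maximalIdeal X.stalk) :=
  (genRank_maximalIdeal X.isRational_stalk).symm

section Comap

variable {X Y : AnalyticGerm} (u : Y ⟶ X)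

/-- A linear map on `𝓞_{Y,y}`, composed with `u^*`. -/
def compComap {W : ModuleCat.{0} Y.stalk} (π : Y.stalk →ₗ[Y.stalk] W) :
    X.stalk →ₗ[X.stalk] viaComap u W where
  toFun a := π (comap u a)
  map_add' a b := by
    rw [map_add, map_add]
    rfl
  map_smul' a b := by
    rw [smul_eq_mul, map_mul, ← smul_eq_mul, map_smul]
    rfl

variable {u}

theorem compComap_surjective (hu : Function.Surjective (comap u))
    {W : ModuleCat.{0} Y.stalk} {π : Y.stalk →ₗ[Y.stalk] W}
    (hπ : Function.Surjective π) : Function.Surjective (compComap u π) :=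
  hπ.comp hu

theorem relBetti_zero (hu : Function.Surjective (comap u)) : relBetti u 0 = 1 := by
  have : Nontrivial (viaComap u Y.self) := inferInstanceAs (Nontrivial Y.stalk)
  exact betti_zero_cyclic X.isRational_stalk
    (compComap_surjective hu (W := Y.self) (π := LinearMap.id) Function.surjective_id)

theorem relBetti_one (hu : Function.Surjective (comap u)) :
    relBetti u 1 = genRank ℂ X.stalk (RingHom.ker (comap u)) := by
  have : Nontrivial (viaComap u Y.self) := inferInstanceAs (Nontrivial Y.stalk)
  exact betti_one_cyclic X.isRational_stalk
    (compComap_surjective hu (W := Y.self) (π := LinearMap.id) Function.surjective_id)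
    fun _ => Iff.rfl

theorem relBetti_two (hu : Function.Surjective (comap u)) :
    relBetti u 2 = LocalAlgebra.betti ℂ (ModuleCat.of X.stalk (RingHom.ker (comap u))) 1 :=
  betti_two_cyclic
    (compComap_surjective hu (W := Y.self) (π := LinearMap.id) Function.surjective_id)
    fun _ => Iff.rfl

end Comap

/-- Largeness is tested on the reduced point, the ideal `𝔪_Y`. The first Betti number of the residue
field is the embedding dimension, and the zeroth Betti numbers are 1. -/
theorem edim_of_isLarge {X Y : AnalyticGerm} {u : Y ⟶ X} (hu : IsLarge u) :
    X.edim = Y.edim + relBetti u 1 := by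
  obtain ⟨hs, hI⟩ := hu
  have hloc : IsLocalHom (comap u).toRingHom := .of_surjective _ hs
  have hm : (maximalIdeal Y.stalk) ≠ ⊤ := (maximalIdeal.isMaximal Y.stalk).ne_top
  have h := congrArg (PowerSeries.coeff 1)
    (hI (maximalIdeal Y.stalk) hm (maximalIdeal.isMaximal Y.stalk).isPrime.isRadical)
  have hnt : Nontrivial (Y.stalk ⧸ maximalIdeal Y.stalk) := Ideal.Quotient.nontrivial_iff.2 hm
  have hntY : Nontrivial (ModuleCat.of Y.stalk (Y.stalk ⧸ maximalIdeal Y.stalk)) := hnt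
  have hntX : Nontrivial
    (viaComap u (ModuleCat.of Y.stalk (Y.stalk ⧸ maximalIdeal Y.stalk))) := hnt
  let π : Y.stalk →ₗ[Y.stalk] ModuleCat.of Y.stalk (Y.stalk ⧸ maximalIdeal Y.stalk) :=
    Submodule.mkQ (maximalIdeal Y.stalk)
  have hπ : Function.Surjective π := Submodule.mkQ_surjective _
  have hπ0 : ∀ b, b ∈ maximalIdeal Y.stalk ↔ π b = 0 := fun b =>
    (Submodule.Quotient.mk_eq_zero _).symm
  rw [PowerSeries.coeff_mul, Finset.Nat.sum_antidiagonal_eq_sum_range_succ_mk,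
    Finset.sum_range_succ, Finset.sum_range_one] at h
  simp only [poincare, PowerSeries.coeff_mk, tsub_zero, tsub_self] at h
  have e₀ : Y.betti (ModuleCat.of Y.stalk (Y.stalk ⧸ maximalIdeal Y.stalk)) 0 = 1 :=
    betti_zero_cyclic Y.isRational_stalk hπ
  have e₁ : Y.betti (ModuleCat.of Y.stalk (Y.stalk ⧸ maximalIdeal Y.stalk)) 1 = Y.edim :=
    (betti_one_cyclic Y.isRational_stalk hπ hπ0).trans Y.edim_eq.symm
  have hcomap : ∀ a, a ∈ maximalIdeal X.stalk ↔ compComap u π a = 0 := fun a => by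
    refine Iff.trans ?_ (hπ0 (comap u a))
    rw [← maximalIdeal_comap (comap u).toRingHom]
    rfl
  have e₂ : X.betti (viaComap u (ModuleCat.of Y.stalk (Y.stalk ⧸ maximalIdeal Y.stalk))) 1 =
      X.edim :=
    (betti_one_cyclic X.isRational_stalk (compComap_surjective hs hπ) hcomap).trans
      X.edim_eq.symm
  have e₃ : X.betti (viaComap u Y.self) 0 = 1 := relBetti_zero hs
  rw [e₀, e₁, e₂, e₃] at h
  change _ = 1 * relBetti u 1 + _ at h
  omega

/-! ### Invariants of a gluing -/

section Gluing

variable {X Y Z V : AnalyticGerm} {α : Z ⟶ X} {β : Z ⟶ Y} {f : X ⟶ V} {g : Y ⟶ V}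

theorem comap_mem_ker (hV : IsPushout α β f g) {a : V.stalk} (ha : a ∈ RingHom.ker (comap g)) :
    comap f a ∈ RingHom.ker (comap α) := by
  have ha : comap g a = 0 := ha
  change comap α (comap f a) = 0
  rw [comap_comap_of_isPushout hV, ha, map_zero]

/-- In the fibre product, `ker g^*` consists of the pairs `(r, 0)` with `α^* r = 0`. -/
theorem exists_kerEquiv (hα : Function.Surjective (comap α)) (hV : IsPushout α β f g)
    [Algebra V.stalk X.stalk] (hf : algebraMap V.stalk X.stalk = (comap f).toRingHom) :
    ∃ e : RingHom.ker (comap g) ≃ₗ[V.stalk] RingHom.ker (comap α),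
      ∀ a, (e a).1 = comap f a.1 := by
  let e : RingHom.ker (comap g) →ₗ[V.stalk] RingHom.ker (comap α) :=
    { toFun a := ⟨comap f a.1, comap_mem_ker hV a.2⟩
      map_add' a b := Subtype.ext (map_add (comap f) _ _)
      map_smul' a b := Subtype.ext (by
        change comap f (a * b.1) = a • comap f b.1
        rw [map_mul, Algebra.smul_def, hf]
        rfl) }
  refine ⟨LinearEquiv.ofBijective e ⟨?_, ?_⟩, fun _ => rfl⟩
  · rw [injective_iff_map_eq_zero]
    intro a ha
    exact Subtype.ext (eq_zero_of_isPushout hV (congrArg Subtype.val ha) a.2)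
  · rintro ⟨r, hr⟩
    have hr' : comap α r = 0 := hr
    obtain ⟨a, ha, ha'⟩ := exists_of_isPushout (s := 0) hα hV (by rw [hr', map_zero])
    exact ⟨⟨a, ha'⟩, Subtype.ext ha⟩

theorem relBetti_one_right (hα : Function.Surjective (comap α))
    (hβ : Function.Surjective (comap β)) (hV : IsPushout α β f g) :
    relBetti g 1 = relBetti α 1 := by
  let _ : Algebra V.stalk X.stalk := (comap f).toRingHom.toAlgebra
  have _ : IsScalarTower ℂ V.stalk X.stalk :=
    IsScalarTower.of_algebraMap_eq fun c => ((comap f).commutes c).symm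
  obtain ⟨e, _⟩ := exists_kerEquiv hα hV rfl
  rw [relBetti_one (comap_right_surjective hα hV), relBetti_one hα, genRank_congr e]
  exact genRank_restrictScalars (comap_left_surjective hα hβ hV)

/-- Second Betti numbers of cyclic modules are first Betti numbers of their ideals, and `ker g^*` is
`ker α^*` viewed over `𝓞_V`. `betti_one_of_large` compares the two rings; `hE` supplies its
condition on `ker f^*`. -/
theorem relBetti_two_right (hα : Function.Surjective (comap α))
    (hβ : Function.Surjective (comap β)) (hV : IsPushout α β f g)
    (hE : V.edim = X.edim + relBetti f 1) :
    relBetti g 2 = relBetti α 2 + relBetti α 1 * relBetti f 1 := by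
  have hf := comap_left_surjective hα hβ hV
  have hloc : IsLocalHom (comap f).toRingHom := .of_surjective _ hf
  let _ : Algebra V.stalk X.stalk := (comap f).toRingHom.toAlgebra
  have _ : IsScalarTower ℂ V.stalk X.stalk :=
    IsScalarTower.of_algebraMap_eq fun c => ((comap f).commutes c).symm
  obtain ⟨e, _⟩ := exists_kerEquiv hα hV rfl
  rw [relBetti_two (comap_right_surjective hα hV), relBetti_two hα, relBetti_one hα,
    relBetti_one hf, betti_congr e.toModuleIso]
  refine betti_one_of_large V.isRational_stalk X.isRational_stalk hf fun x hx => ?_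
  have hle : ∀ a ∈ RingHom.ker (algebraMap V.stalk X.stalk), a ∈ maximalIdeal V.stalk :=
    fun a ha => le_maximalIdeal (RingHom.ker_ne_top _) ha
  let p : maximalIdeal V.stalk →ₗ[V.stalk] maximalIdeal X.stalk :=
    { toFun a := ⟨comap f a.1, map_nonunit (comap f).toRingHom _ a.2⟩
      map_add' a b := Subtype.ext (map_add (comap f) _ _)
      map_smul' a b := Subtype.ext (map_mul (comap f) _ _) }
  let i : RingHom.ker (algebraMap V.stalk X.stalk) →ₗ[V.stalk] maximalIdeal V.stalk :=
    Submodule.inclusion hle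
  -- By `hE`, generator counts are additive along `0 → ker f^* → 𝔪_V → 𝔪_X → 0`.
  refine mem_smul_of_genRank_eq (u := i) (v := p) V.isRational_stalk ?_ ?_ ?_ x ?_
  · intro a
    constructor
    · intro ha
      exact ⟨⟨a.1, congrArg Subtype.val ha⟩, rfl⟩
    · rintro ⟨b, rfl⟩
      exact Subtype.ext b.2
  · rintro ⟨r, hr⟩
    obtain ⟨a, rfl⟩ := hf r
    exact ⟨⟨a, mem_maximalIdeal_of_map (comap f).toRingHom hr⟩, rfl⟩
  · rw [← edim_eq, hE, relBetti_one hf, add_comm, edim_eq,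
      genRank_restrictScalars (A := V.stalk) (B := X.stalk) (M := maximalIdeal X.stalk) hf]
    rfl
  · have hmap : Submodule.map (Submodule.subtype (maximalIdeal V.stalk))
        (maximalIdeal V.stalk • ⊤ : Submodule V.stalk (maximalIdeal V.stalk)) =
        maximalIdeal V.stalk * maximalIdeal V.stalk := by
      rw [Submodule.map_smul'', Submodule.map_top, Submodule.range_subtype, smul_eq_mul]
    rw [← hmap] at hx
    obtain ⟨y, hy, hyx⟩ := hx
    have : i x = y := Subtype.ext hyx.symm
    rwa [this]

/-- The embedding dimension of a gluing along which `β^*` factors through `α^*`. -/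
theorem edim_of_factor (hα : Function.Surjective (comap α))
    (hβ : Function.Surjective (comap β)) (hV : IsPushout α β f g) (φ : Y.stalk →+* X.stalk)
    (hφ : (comap α).toRingHom.comp φ = (comap β).toRingHom) :
    V.edim = relBetti α 1 + Y.edim := by
  have hf := comap_left_surjective hα hβ hV
  have hg := comap_right_surjective hα hV
  have hlocf : IsLocalHom (comap f).toRingHom := .of_surjective _ hf
  have hlocg : IsLocalHom (comap g).toRingHom := .of_surjective _ hg
  have hlocβ : IsLocalHom (comap β).toRingHom := .of_surjective _ hβ
  let _ : Algebra V.stalk X.stalk := (comap f).toRingHom.toAlgebra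
  let _ : Algebra V.stalk Y.stalk := (comap g).toRingHom.toAlgebra
  have _ : IsScalarTower ℂ V.stalk Y.stalk :=
    IsScalarTower.of_algebraMap_eq fun c => ((comap g).commutes c).symm
  obtain ⟨e, he⟩ := exists_kerEquiv hα hV rfl
  have hφ' : ∀ s, comap α (φ s) = comap β s := fun s => RingHom.congr_fun hφ s
  have hφm : ∀ a ∈ maximalIdeal V.stalk, φ (comap g a) ∈ maximalIdeal X.stalk := fun a ha =>
    mem_maximalIdeal_of_map (comap α).toRingHom (by
      change comap α (φ (comap g a)) ∈ _
      rw [hφ']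
      exact map_nonunit (comap β).toRingHom _ (map_nonunit (comap g).toRingHom _ ha))
  have hle : ∀ a ∈ RingHom.ker (comap g), a ∈ maximalIdeal V.stalk :=
    fun a ha => le_maximalIdeal (RingHom.ker_ne_top _) ha
  -- the deviation of the two maps to `𝓞_{X,x}` lies in `ker α^*`
  have hδ : ∀ a, comap f a - φ (comap g a) ∈ RingHom.ker (comap α) := fun a => by
    change comap α _ = 0
    rw [map_sub, hφ', comap_comap_of_isPushout hV, sub_self]
  -- For `δ = f^* - φ g^*` the product rule `δ(ab) = f^*(a) δ(b) + φ(g^* b) δ(a)` holds, and both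
  -- coefficients lie in `𝔪_X` when `a` and `b` lie in `𝔪_V`.
  have hδmul : ∀ z ∈ (maximalIdeal V.stalk • ⊤ : Submodule V.stalk (maximalIdeal V.stalk)),
      ∃ y ∈ (maximalIdeal X.stalk • ⊤ : Submodule X.stalk (RingHom.ker (comap α))),
        y.1 = comap f z.1 - φ (comap g z.1) := by
    intro z hz
    induction hz using Submodule.smul_induction_on' with
    | smul a ha b _ =>
      refine ⟨comap f a • ⟨_, hδ b.1⟩ + φ (comap g b.1) • ⟨_, hδ a⟩, add_mem
        (Submodule.smul_mem_smul (map_nonunit (comap f).toRingHom _ ha) Submodule.mem_top)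
        (Submodule.smul_mem_smul (hφm _ b.2) Submodule.mem_top), ?_⟩
      change comap f a * (comap f b.1 - φ (comap g b.1)) +
        φ (comap g b.1) * (comap f a - φ (comap g a)) = comap f (a * b.1) - φ (comap g (a * b.1))
      simp only [map_mul]
      ring
    | add a _ b _ ha hb =>
      obtain ⟨y, hy, hya⟩ := ha
      obtain ⟨y', hy', hyb⟩ := hb
      refine ⟨y + y', add_mem hy hy', ?_⟩
      change y.1 + y'.1 = comap f (a.1 + b.1) - φ (comap g (a.1 + b.1))
      rw [hya, hyb]
      simp only [map_add]
      ring
  let p : maximalIdeal V.stalk →ₗ[V.stalk] maximalIdeal Y.stalk :=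
    { toFun a := ⟨comap g a.1, map_nonunit (comap g).toRingHom _ a.2⟩
      map_add' a b := Subtype.ext (map_add (comap g) _ _)
      map_smul' a b := Subtype.ext (map_mul (comap g) _ _) }
  let i : RingHom.ker (comap g) →ₗ[V.stalk] maximalIdeal V.stalk := Submodule.inclusion hle
  have key : genRank ℂ V.stalk (maximalIdeal V.stalk) =
      genRank ℂ V.stalk (RingHom.ker (comap g)) + genRank ℂ V.stalk (maximalIdeal Y.stalk) := by
    refine genRank_add_of_exact (u := i) (v := p) V.isRational_stalk ?_ ?_ ?_
    · intro a
      constructor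
      · intro ha
        exact ⟨⟨a.1, congrArg Subtype.val ha⟩, rfl⟩
      · rintro ⟨b, rfl⟩
        exact Subtype.ext b.2
    · rintro ⟨r, hr⟩
      obtain ⟨a, rfl⟩ := hg r
      exact ⟨⟨a, mem_maximalIdeal_of_map (comap g).toRingHom hr⟩, rfl⟩
    -- On `ker g^*` the map `δ` is `e`. Hence `e x` lies in `𝔪_X ker α^*`, which is `𝔪_V ker α^*`,
    -- and `e.symm` carries this back.
    · intro x hx
      obtain ⟨y, hy, hyx⟩ := hδmul _ hx
      have hx0 : comap g x.1 = 0 := x.2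
      have hy' : y = e x := Subtype.ext (by
        rw [hyx, he]
        change comap f x.1 - φ (comap g x.1) = _
        rw [hx0, map_zero, sub_zero])
      have h1 : y ∈ (maximalIdeal X.stalk • ⊤ :
          Submodule X.stalk (RingHom.ker (comap α))).restrictScalars V.stalk := hy
      rw [restrictScalars_smul_top (A := V.stalk) hf, hy'] at h1
      have h2 := map_mem_smul_top e.symm.toLinearMap h1
      rwa [LinearEquiv.coe_coe, LinearEquiv.symm_apply_apply] at h2
  rw [edim_eq, key, ← relBetti_one hg, relBetti_one_right hα hβ hV, edim_eq,
    genRank_restrictScalars (A := V.stalk) (B := Y.stalk) (M := maximalIdeal Y.stalk) hg]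

/-- A surjective `α^*` that is not bijective has nonzero kernel, and by Nakayama a nonzero finite
module needs a generator. -/
theorem relBetti_one_ne_zero (hα : Function.Surjective (comap α))
    (hα' : ¬ Function.Bijective (comap α)) : relBetti α 1 ≠ 0 := by
  rw [relBetti_one hα]
  have : Nontrivial (RingHom.ker (comap α)) := by
    rw [Submodule.nontrivial_iff_ne_bot]
    intro h
    exact hα' ⟨(RingHom.injective_iff_ker_eq_bot _).2 h, hα⟩
  exact genRank_ne_zero X.isRational_stalk

end Gluing

end AnalyticGerm

end

theorem corollary4p1 {X Y Z V : AnalyticGerm}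
    (α : Z ⟶ X) (β : Z ⟶ Y) (f : X ⟶ V) (g : Y ⟶ V)
    (hα : Function.Surjective (AnalyticGerm.comap α))
    (hβ : Function.Surjective (AnalyticGerm.comap β))
    (hXZ : ¬ Function.Bijective (AnalyticGerm.comap α))
    (hYZ : ¬ Function.Bijective (AnalyticGerm.comap β))
    (hV : IsPushout α β f g) :
    (AnalyticGerm.IsLarge f →
      (V.edim : ℚ) =
        1 / (AnalyticGerm.relBetti α 1 : ℚ) *
          ((AnalyticGerm.relBetti g 1 : ℚ) *
              ((X.edim : ℚ) * (AnalyticGerm.relBetti α 1 : ℚ)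
                - (AnalyticGerm.relBetti α 2 : ℚ)) /
              (AnalyticGerm.relBetti α 1 : ℚ)
            + (AnalyticGerm.relBetti g 2 : ℚ))) ∧
    ((AnalyticGerm.IsWeaklyLarge α f ∧
          (∃ φ : Y.stalk →+* X.stalk, Function.Surjective φ ∧
            (AnalyticGerm.comap α).toRingHom.comp φ = (AnalyticGerm.comap β).toRingHom)) ∨
        (AnalyticGerm.IsLarge f ∧ AnalyticGerm.IsLarge g) →
      V.edim = AnalyticGerm.relBetti α 1 + Y.edim) := by
  refine ⟨fun hf => ?_, ?_⟩
  · have hE := AnalyticGerm.edim_of_isLarge hf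
    have h0 : (AnalyticGerm.relBetti α 1 : ℚ) ≠ 0 :=
      Nat.cast_ne_zero.2 (AnalyticGerm.relBetti_one_ne_zero hα hXZ)
    -- Everything is now expressed through `edim X`, `β_1^X(Z)`, `β_2^X(Z)` and `β_1^V(X)`; the
    -- terms in `β_2^X(Z)` cancel.
    rw [AnalyticGerm.relBetti_two_right hα hβ hV hE, AnalyticGerm.relBetti_one_right hα hβ hV, hE]
    push_cast
    field_simp
    ring
  · rintro (⟨_, φ, _, hφ⟩ | ⟨_, hg⟩)
    · exact AnalyticGerm.edim_of_factor hα hβ hV φ hφ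
    · rw [AnalyticGerm.edim_of_isLarge hg, AnalyticGerm.relBetti_one_right hα hβ hV, add_comm]
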